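/- Let $G$ be a simply connected complex semisimple group with Borel subgroup $B$ and maximal torus $T\subset B$; let $X^*(T)$ be its weight lattice, $R=R^+\sqcup -R^+$ its roots ($R^+$ the roots in $B$), $W$ its Weyl group, with length $\ell$ and Bruhat order $<$, and let $s_\alpha$ be the reflection in the root $\alpha$. The affine Hecke algebra $\mathbb H$ is the $\mathbb Z[q,q^{-1}]$-algebra generated by $T_w$ ($w\in W$) and $X^\lambda$ ($\lambda\in X^*(T)$), with the relations $X^\lambda X^\mu=X^{\lambda+\mu}$, $X^0=T_1=1$, $T_wT_y=T_{wy}$ whenever $\ell(wy)=\ell(w)+\ell(y)$, and, for every simple root $\alpha$ and every $\lambda\in X^*(T)$, $$(T_{s_\alpha}+1)(T_{s_\alpha}-q)=0,\qquad T_{s_\alpha}X^\lambda-X^{s_\alpha\lambda}T_{s_\alpha}=(1-q)\frac{X^{s_\alpha\lambda}-X^\lambda}{1-X^{-\alpha}}.$$ The families $\{T_{w^{-1}}^{-1}X^\lambda\}$ and $\{X^\mu T_{u^{-1}}^{-1}\}$ ($w,u\in W$, $\lambda,\mu\in X^*(T)$) are bases of $\mathbb H$ over $\mathbb Z[q,q^{-1}]$;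 define $c^{w,\lambda}_{u,\mu}\in\mathbb Z[q,q^{-1}]$ by $$T_{w^{-1}}^{-1}X^\lambda=\sum_{u\in W,\ \mu\in X^*(T)}c^{w,\lambda}_{u,\mu}\,X^\mu T_{u^{-1}}^{-1}.$$ For a root $\alpha$ and $k\in\mathbb Z$ put $H_{\alpha,k}=\{x\in\mathfrak t^*_{\mathbb R}:\langle x,\alpha^\vee\rangle=k\}$, and let $s_{\alpha,k}(x)=s_\alpha(x)+k\alpha$ be the reflection in $H_{\alpha,k}$. Alcoves are the connected components of the complement of all the $H_{\alpha,k}$, and $\mathfrak A=\{x:0<\langle x,\alpha^\vee\rangle<1\text{ for all }\alpha\in R^+\}$ is the fundamental alcove. Let $\lambda\in X^*(T)$ and let $(\beta_1,\dots,\beta_l)$ be a reduced $\lambda$-chain with separating hyperplanes $H_{-\beta_j,d_j}$: there are alcoves $\mathfrak A=A_0,A_1,\dots,A_l=\mathfrak A-\lambda$ such that $A_{j-1}$ and $A_j$ are separated by a common wall lying on $H_{-\beta_j,d_j}$, the root $-\beta_j$ points from $A_{j-1}$ to $A_j$ $(1\le j\le l)$, and $l$ is the least length of such a path of adjacent alcoves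 from $\mathfrak A$ to $\mathfrak A-\lambda$. Put $\hat r_j=s_{-\beta_j,d_j}$ and $\tilde r_j=s_{\beta_j,\,\langle\lambda,\beta_j^\vee\rangle-d_j}$, and for $J\subset\{1,\dots,l\}$ put $n(J)=\#\{j\in J:\beta_j\in -R^+\}$. Then for all $w,u\in W$ and $\mu\in X^*(T)$: (1) $$c^{w,-\lambda}_{u,\mu}=\sum_{J}(-1)^{n(J)}(1-q)^{|J|}q^{\frac{\ell(u)-\ell(w)-|J|}{2}},$$ where the sum is over the subsets $J=\{j_1<\dots<j_t\}\subset\{1,\dots,l\}$ such that $u<us_{\beta_{j_t}}<us_{\beta_{j_t}}s_{\beta_{j_{t-1}}}<\dots<us_{\beta_{j_t}}\cdots s_{\beta_{j_1}}=w$ and $w\,\hat r_{j_1}\cdots\hat r_{j_t}(-\lambda)=\mu$; (2) $$c^{w,\lambda}_{u,\mu}=\sum_{J}(-1)^{n(J)}(q-1)^{|J|}q^{\frac{\ell(u)-\ell(w)-|J|}{2}},$$ where the sum is over the subsets $J=\{j_1<\dots<j_t\}\subset\{1,\dots,l\}$ such that $u<us_{\beta_{j_1}}<us_{\beta_{j_1}}s_{\beta_{j_2}}<\dots<us_{\beta_{j_1}}\cdots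 s_{\beta_{j_t}}=w$ and $w\,\tilde r_{j_t}\cdots\tilde r_{j_1}(\lambda)=\mu$. (The exponents of $q$ are integers for all the $J$ that occur.) -/

import Mathlib

open scoped LaurentPolynomial

noncomputable section

/-!
Setting.  A simply connected complex semisimple group `G ⊇ B ⊇ T` enters only through its root
datum: `X = X^*(T)`, `Y = X_*(T)`, the perfect pairing `X × Y → ℤ`, the roots and coroots, and the
base of simple roots attached to `B`.  Such root data are the reduced finite root data whose coroots
span `Y` over `ℤ`.  Roots are referred to by their index `i : ι`.
-/

namespace HeckeChain

variable {ι X Y : Type*} [AddCommGroup X] [AddCommGroup Y]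

/-! ### Weyl group: length and Bruhat order -/

section Weyl

variable {P : RootPairing ι ℤ X Y} (b : P.Base)

/-- The length of `w`: the least length of an expression of `w` as a product of simple
reflections. -/
def len (w : P.weylGroup) : ℕ :=
  sInf {n | ∃ L : List ι, (∀ i ∈ L, i ∈ b.support) ∧ L.length = n ∧
    (L.map (RootPairing.weylGroup.ofIdx P)).prod = w}

/-- The strict Bruhat order: the transitive closure of the relations `u < u s_α`, for `α` a root
with `ℓ(u) < ℓ(u s_α)`. -/
def BruhatLT (u w : P.weylGroup) : Prop :=
  Relation.TransGen
    (fun x y => ∃ i : ι, y = x * RootPairing.weylGroup.ofIdx P i ∧ len b x < len b y) u w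

/-- For a list of roots `γ₁, …, γ_t`:
`u < u s_{γ₁} < u s_{γ₁} s_{γ₂} < ⋯ < u s_{γ₁} ⋯ s_{γ_t} = w`. -/
def BruhatChain : P.weylGroup → List ι → P.weylGroup → Prop
  | u, [], w => u = w
  | u, i :: L, w =>
      BruhatLT b u (u * RootPairing.weylGroup.ofIdx P i) ∧
        BruhatChain (u * RootPairing.weylGroup.ofIdx P i) L w

end Weyl

/-! ### The affine Hecke algebra -/

section Hecke

/-- The ground ring `ℤ[q, q⁻¹]`. -/
abbrev R : Type := ℤ[T;T⁻¹]

/-- The parameter `q`. -/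
def q : R := LaurentPolynomial.T 1

/-- The quotient `(X^{s_α λ} - X^λ) / (1 - X^{-α})`, a sum of `X^μ`'s, for `α` the root of index
`i`; here `x μ` stands for `X^μ`.  With `n = ⟨λ, α^∨⟩`, it is `-∑_{0 ≤ k < n} X^{λ - kα}` if
`n ≥ 0`, and `∑_{1 ≤ k ≤ -n} X^{λ + kα}` if `n < 0`.  See `divDiff_mul`. -/
def divDiff (P : RootPairing ι ℤ X Y) {A : Type*} [AddCommGroup A] (x : X → A) (i : ι) (lam : X) :
    A :=
  if 0 ≤ P.coroot' i lam then
    -∑ k ∈ Finset.range (P.coroot' i lam).toNat, x (lam - (k : ℤ) • P.root i)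
  else
    ∑ k ∈ Finset.range (-P.coroot' i lam).toNat, x (lam + ((k : ℤ) + 1) • P.root i)

/-- `divDiff` is the stated quotient. -/
theorem divDiff_mul (P : RootPairing ι ℤ X Y) {A : Type*} [Ring A] (x : X → A)
    (hx : ∀ a c, x (a + c) = x a * x c) (i : ι) (lam : X) :
    divDiff P x i lam * (1 - x (-P.root i)) = x (P.reflection i lam) - x lam := by
  rw [RootPairing.reflection_apply]
  unfold divDiff
  generalize P.coroot' i lam = n
  split_ifs with h
  · obtain ⟨m, rfl⟩ := Int.eq_ofNat_of_zero_le h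
    simp only [Int.toNat_natCast]
    induction m with
    | zero => simp
    | succ m ih =>
      rw [Finset.sum_range_succ, neg_add, add_mul, ih (by positivity), mul_sub, mul_one,
        neg_mul (x _) (x _), ← hx]
      have e : lam - (m : ℤ) • P.root i + -P.root i = lam - ((m + 1 : ℕ) : ℤ) • P.root i := by
        push_cast
        rw [add_smul, one_smul]
        abel
      rw [e]
      abel
  · obtain ⟨m, hm⟩ := Int.eq_ofNat_of_zero_le (a := -n) (by omega)
    obtain rfl : n = -(m : ℤ) := by omega
    clear h hm
    simp only [neg_neg, Int.toNat_natCast]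
    induction m with
    | zero => simp
    | succ m ih =>
      rw [Finset.sum_range_succ, add_mul, ih, mul_sub, mul_one, ← hx]
      have e : lam + ((m : ℤ) + 1) • P.root i + -P.root i = lam - (-(m : ℤ)) • P.root i := by
        rw [add_smul, one_smul, neg_smul]
        abel
      have e' : lam - (-((m + 1 : ℕ) : ℤ)) • P.root i = lam + ((m : ℤ) + 1) • P.root i := by
        push_cast
        rw [neg_smul, sub_neg_eq_add]
      rw [e, e']
      abel

variable {P : RootPairing ι ℤ X Y} (b : P.Base)

/-- The generators: `T_w` for `w` in the Weyl group and `X^λ` for `λ` in the weight lattice. -/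
abbrev Gen (P : RootPairing ι ℤ X Y) : Type _ := P.weylGroup ⊕ X

/-- The generator `T_w` in the free algebra. -/
def genT (w : P.weylGroup) : FreeAlgebra R (Gen P) := FreeAlgebra.ι R (Sum.inl w)

/-- The generator `X^λ` in the free algebra. -/
def genX (lam : X) : FreeAlgebra R (Gen P) := FreeAlgebra.ι R (Sum.inr lam)

/-- The defining relations of the affine Hecke algebra. -/
inductive Rel : FreeAlgebra R (Gen P) → FreeAlgebra R (Gen P) → Prop
  | T_one : Rel (genT 1) 1
  | X_zero : Rel (genX 0) 1
  | X_add (lam mu : X) : Rel (genX lam * genX mu) (genX (lam + mu))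
  | quadratic (i : ι) (hi : i ∈ b.support) :
      Rel ((genT (RootPairing.weylGroup.ofIdx P i) + 1) *
        (genT (RootPairing.weylGroup.ofIdx P i) - algebraMap R _ q)) 0
  | T_mul (w y : P.weylGroup) (h : len b (w * y) = len b w + len b y) :
      Rel (genT w * genT y) (genT (w * y))
  | bernstein (i : ι) (hi : i ∈ b.support) (lam : X) :
      Rel (genT (RootPairing.weylGroup.ofIdx P i) * genX lam -
          genX (P.reflection i lam) * genT (RootPairing.weylGroup.ofIdx P i))
        ((1 - q) • divDiff P genX i lam)

/-- The affine Hecke algebra, a `ℤ[q, q⁻¹]`-algebra. -/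
abbrev AffineHecke : Type _ := RingQuot (Rel b)

/-- The element `T_w` of the affine Hecke algebra. -/
def heckeT (w : P.weylGroup) : AffineHecke b := RingQuot.mkAlgHom R (Rel b) (genT w)

/-- The element `X^λ` of the affine Hecke algebra. -/
def heckeX (lam : X) : AffineHecke b := RingQuot.mkAlgHom R (Rel b) (genX lam)

/-- The element `T_{w⁻¹}⁻¹` of the affine Hecke algebra (every `T_w` is invertible). -/
def heckeTinv (w : P.weylGroup) : AffineHecke b := Ring.inverse (heckeT b w⁻¹)

end Hecke

/-! ### Alcoves, alcove paths, chains of roots -/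

section Alcoves

/-- The real vector space `𝔱^*_ℝ = Hom(X_*(T), ℝ)`. -/
def RealWeights (Y : Type*) [AddCommGroup Y] : Type _ := Y →ₗ[ℤ] ℝ

instance : AddCommGroup (RealWeights Y) := inferInstanceAs (AddCommGroup (Y →ₗ[ℤ] ℝ))

instance : Module ℝ (RealWeights Y) := inferInstanceAs (Module ℝ (Y →ₗ[ℤ] ℝ))

instance : FunLike (RealWeights Y) Y ℝ := inferInstanceAs (FunLike (Y →ₗ[ℤ] ℝ) Y ℝ)

/-- The topology of pointwise convergence, which is the usual topology as `Y` is finitely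
generated. -/
instance : TopologicalSpace (RealWeights Y) :=
  TopologicalSpace.induced (fun x : RealWeights Y => (fun y : Y => x y)) inferInstance

variable (P : RootPairing ι ℤ X Y)

/-- A weight as a point of `𝔱^*_ℝ`. -/
def toReal (lam : X) : RealWeights Y :=
  (Algebra.linearMap ℤ ℝ).comp (P.toLinearMap lam)

/-- The hyperplane `H_{α, k}`, for `α` the root of index `i`. -/
def hyperplane (i : ι) (k : ℤ) : Set (RealWeights Y) := {x | x (P.coroot i) = (k : ℝ)}

/-- The complement of all the hyperplanes. -/
def regularSet : Set (RealWeights Y) := {x | ∀ (i : ι) (k : ℤ), x ∉ hyperplane P i k}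

/-- Alcoves are the connected components of the complement of the hyperplanes. -/
def IsAlcove (A : Set (RealWeights Y)) : Prop :=
  ∃ x ∈ regularSet P, A = connectedComponentIn (regularSet P) x

/-- `A` and `A'` are separated by a common wall (codimension one face) lying on `H_{α, k}`, and `α`
points from `A` to `A'`, where `α` is the root of index `i`. -/
structure Crosses (A A' : Set (RealWeights Y)) (i : ι) (k : ℤ) : Prop where
  left : ∀ x ∈ A, x (P.coroot i) < k
  right : ∀ x ∈ A', k < x (P.coroot i)
  wall : (affineSpan ℝ (closure A ∩ closure A') : Set (RealWeights Y)) = hyperplane P i k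

/-- The index of the root `-α`, for `α` the root of index `i`. -/
def negIdx (i : ι) : ι := P.reflectionPerm i i

/-- `A₀ → A₁ → ⋯ → A_l` is an alcove path, in which the step from `A_{j-1}` to `A_j` crosses
`H_{-β_j, d_j}` in the direction of the root `-β_j`. -/
structure IsAlcovePath {l : ℕ} (A : Fin (l + 1) → Set (RealWeights Y)) (β : Fin l → ι)
    (d : Fin l → ℤ) : Prop where
  alcove : ∀ j, IsAlcove P (A j)
  step : ∀ j : Fin l, Crosses P (A j.castSucc) (A j.succ) (negIdx P (β j)) (d j)

variable {P} (b : P.Base)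

/-- The fundamental alcove. -/
def fundAlcove : Set (RealWeights Y) :=
  {x | ∀ i, b.IsPos i → 0 < x (P.coroot i) ∧ x (P.coroot i) < 1}

/-- The fundamental alcove translated by `-λ`. -/
def fundAlcoveSub (lam : X) : Set (RealWeights Y) :=
  (fun x => x - toReal P lam) '' fundAlcove b

/-- `(β₁, d₁), …, (β_l, d_l)` is a reduced `λ`-chain: the roots `β_j` and the hyperplanes
`H_{-β_j, d_j}` come from an alcove path from the fundamental alcove to its translate by `-λ`, of
minimal length among all such alcove paths. -/
def IsReducedChain (lam : X) {l : ℕ} (β : Fin l → ι) (d : Fin l → ℤ) : Prop :=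
  (∃ A : Fin (l + 1) → Set (RealWeights Y), IsAlcovePath P A β d ∧ A 0 = fundAlcove b ∧
    A (Fin.last l) = fundAlcoveSub b lam) ∧
  ∀ (m : ℕ) (A : Fin (m + 1) → Set (RealWeights Y)) (γ : Fin m → ι) (e : Fin m → ℤ),
    IsAlcovePath P A γ e → A 0 = fundAlcove b → A (Fin.last m) = fundAlcoveSub b lam → l ≤ m

end Alcoves

/-! ### The two sums over subsets `J` -/

section Sums

variable (P : RootPairing ι ℤ X Y)

/-- The affine reflection `s_{α, k}` in `H_{α, k}`, for `α` the root of index `i`: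
`μ ↦ s_α(μ) + k α`. -/
def affRefl (i : ι) (k : ℤ) (mu : X) : X := P.reflection i mu + k • P.root i

/-- `r̂_{J<} = r̂_{h_{j₁}} ⋯ r̂_{h_{j_t}}` where `J = {j₁ < ⋯ < j_t}`, for the hyperplanes
`h_j = H_{-β_j, d_j}`. -/
def rHat {l : ℕ} (β : Fin l → ι) (d : Fin l → ℤ) (J : Finset (Fin l)) (mu : X) : X :=
  (J.sort (· ≤ ·)).foldr (fun j nu => affRefl P (negIdx P (β j)) (d j) nu) mu

/-- `r̃_{J>} = r̃_{h_{j_t}} ⋯ r̃_{h_{j₁}}` where `J = {j₁ < ⋯ < j_t}` and `r̃_{h_j}` is the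
reflection in `H_{β_j, ⟨λ, β_j^∨⟩ - d_j}`. -/
def rTilde (lam : X) {l : ℕ} (β : Fin l → ι) (d : Fin l → ℤ) (J : Finset (Fin l)) (mu : X) : X :=
  (J.sort (· ≥ ·)).foldr (fun j nu => affRefl P (β j) (P.coroot' (β j) lam - d j) nu) mu

variable {P} (b : P.Base)

/-- `n(J)`, the number of `j ∈ J` with `β_j < 0`. -/
def nNeg {l : ℕ} (β : Fin l → ι) (J : Finset (Fin l)) : ℕ :=
  Set.ncard {j | j ∈ J ∧ ¬ b.IsPos (β j)}

/-- `u → w` along `J` in decreasing order: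
`u < u s_{β_{j_t}} < ⋯ < u s_{β_{j_t}} ⋯ s_{β_{j₁}} = w`. -/
def ChainDesc {l : ℕ} (β : Fin l → ι) (J : Finset (Fin l)) (u w : P.weylGroup) : Prop :=
  BruhatChain b u ((J.sort (· ≥ ·)).map β) w

/-- `u → w` along `J` in increasing order:
`u < u s_{β_{j₁}} < ⋯ < u s_{β_{j₁}} ⋯ s_{β_{j_t}} = w`. -/
def ChainAsc {l : ℕ} (β : Fin l → ι) (J : Finset (Fin l)) (u w : P.weylGroup) : Prop :=
  BruhatChain b u ((J.sort (· ≤ ·)).map β) w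

/-- The power `q^{(ℓ(u) - ℓ(w) - t)/2}`.  It is only used when `w` is obtained from `u` by `t`
reflections; each of them changes the parity of the length, so that the exponent is an integer. -/
def qPow (u w : P.weylGroup) (t : ℕ) : R :=
  LaurentPolynomial.T (((len b u : ℤ) - (len b w : ℤ) - (t : ℤ)) / 2)

open Classical in
/-- The sum of `(-1)^{n(J)} (1-q)^{|J|} q^{(ℓ(u)-ℓ(w)-|J|)/2}` over the subsets `J` for which `u → w`
along `J` in decreasing order and `w r̂_{J<}(-λ) = μ`. -/
def chainSumNeg (lam : X) {l : ℕ} (β : Fin l → ι) (d : Fin l → ℤ) (w u : P.weylGroup) (mu : X) :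
    R :=
  ∑ J : Finset (Fin l) with ChainDesc b β J u w ∧ w • rHat P β d J (-lam) = mu,
    (-1) ^ nNeg b β J * (1 - q) ^ J.card * qPow b u w J.card

open Classical in
/-- The sum of `(-1)^{n(J)} (q-1)^{|J|} q^{(ℓ(u)-ℓ(w)-|J|)/2}` over the subsets `J` for which `u → w`
along `J` in increasing order and `w r̃_{J>}(λ) = μ`. -/
def chainSumPos (lam : X) {l : ℕ} (β : Fin l → ι) (d : Fin l → ℤ) (w u : P.weylGroup) (mu : X) :
    R :=
  ∑ J : Finset (Fin l) with ChainAsc b β J u w ∧ w • rTilde P lam β d J lam = mu,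
    (-1) ^ nNeg b β J * (q - 1) ^ J.card * qPow b u w J.card

end Sums

end HeckeChain

end

/-!
The affine Hecke algebra acts on the free module with basis the elements `x ↦ ν + w x` of the
extended affine Weyl group, thought of as the alcoves `ν + w 𝔄`: `X^μ` translates, and
`q^{1/2} T_s⁻¹` for a simple reflection `s` sends an alcove `A` to `s A` plus
`(q^{-1/2} - q^{1/2})` times a signed sum over the translates of `A` along the root of `s`
that lie between `A` and `s A` (`tauOp`). The square root of `q` is adjoined for convenience. Since
`X^μ T_{u⁻¹}⁻¹` takes the first basis vector to a power of `q^{1/2}` times the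
basis vector of `(u, μ)`, the coefficients of an element `a` of the algebra in terms of
the `X^μ T_{u⁻¹}⁻¹` are read off from the action of `a` on the first basis vector
(`algebraMap_basisXT_repr`).

To compute the action of `T_{w⁻¹}⁻¹ X^{-λ}` on this vector, operators on the other side are used.
The operator `tauOp` makes sense for any position of the base alcove, not only for the fundamental
one. For the crossing of a hyperplane by the base alcove, the operator `foldOp`, which crosses or,
where the Bruhat order allows it, folds, intertwines the operators of the simple reflections for the
positions before and after the crossing (`tauOp_comp_foldOp`). So does, for a whole alcove path, the
product of these operators (`tauOp_comp_pathOp`). When the path leads from the fundamental alcove to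
its translate by `y`, translating back gives an operator that commutes with all `T_w` and takes the
first basis vector to that of the translation by `y`. Hence `T_{w⁻¹}⁻¹ X^y` acts on the first basis
vector as this operator does on the basis vector of `w` (`rep_elTinv_mul_elX_ket`), and expanding
the product over the places where the path folds gives the sum over the subsets `J`
(`transOp_pathOp_ket_apply`). A `λ`-chain gives the case `y = -λ`. Traversed backwards and
translated by `λ`, it gives the case `y = λ`.

The same operators show that the action is well defined. Generic straight lines provide alcove paths
from the fundamental alcove to all its translates (`exists_stepPath`), so that the operators
commuting with the simple generators move the first basis vector to every other one
(`exists_commuting_ket`). Therefore an identity between polynomials in the simple generators holds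
as soon as it holds on the first basis vector (`BiCommutes.ext`), where the quadratic and braid
relations are visible. The relation between `T_s` and `X^λ` is a computation with sums along a
string of weights (`tauOp_comp_leftOp`). The basis property of the `T_{w⁻¹}⁻¹ X^λ` follows from that
of the `X^μ T_{u⁻¹}⁻¹` by the anti-involution `T_w ↦ T_{w⁻¹}`, `X^λ ↦ X^λ`.
-/

noncomputable section

namespace HeckeChain

open RootPairing.weylGroup (ofIdx)

/-! ### The Weyl group: action on weights and roots, length, Bruhat order -/

section WeylAction

variable {ι X Y : Type*} [AddCommGroup X] [AddCommGroup Y] (P : RootPairing ι ℤ X Y)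

instance smulCommClass_weylGroup_int : SMulCommClass P.weylGroup ℤ X where
  smul_comm w n x := (smul_comm (w : P.Aut) n x :)

theorem root_weyl_smul (w : P.weylGroup) (j : ι) : P.root (w • j) = w • P.root j :=
  (P.weylGroup_apply_root w j).symm

theorem ofIdx_smul_idx (i j : ι) : ofIdx P i • j = P.reflectionPerm i j := by
  apply P.root.injective
  rw [root_weyl_smul, RootPairing.weylGroup.ofIdx_smul, RootPairing.Equiv.reflection_smul,
    RootPairing.root_reflectionPerm]

theorem ofIdx_smul (i : ι) (x : X) : ofIdx P i • x = x - P.coroot' i x • P.root i := by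
  rw [RootPairing.weylGroup.ofIdx_smul, RootPairing.Equiv.reflection_smul,
    RootPairing.reflection_apply]

theorem coroot'_weyl_smul (w : P.weylGroup) (j : ι) (x : X) :
    P.coroot' (w • j) (w • x) = P.coroot' j x := by
  obtain ⟨w, hw⟩ := w
  induction hw using RootPairing.weylGroup.induction generalizing j x with
  | mem i =>
    change P.coroot' (ofIdx P i • j) (ofIdx P i • x) = _
    rw [ofIdx_smul_idx, RootPairing.weylGroup.ofIdx_smul, RootPairing.Equiv.reflection_smul,
      RootPairing.coroot'_reflection, RootPairing.reflectionPerm_self]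
  | one => rfl
  | mul x y hx hy ihx ihy => exact (ihx _ _).trans (ihy _ _)

theorem coroot'_weyl_smul_right (w : P.weylGroup) (j : ι) (x : X) :
    P.coroot' j (w • x) = P.coroot' (w⁻¹ • j) x := by
  rw [← coroot'_weyl_smul P w (w⁻¹ • j) x, smul_inv_smul]

theorem weylGroup_ext {w w' : P.weylGroup} (h : ∀ x : X, w • x = w' • x) : w = w' := by
  apply Subtype.ext
  apply RootPairing.Equiv.weightHom_injective P
  exact LinearEquiv.ext h

theorem conj_ofIdx (w : P.weylGroup) (i : ι) : w * ofIdx P i * w⁻¹ = ofIdx P (w • i) := by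
  apply weylGroup_ext
  intro x
  rw [mul_smul, mul_smul, ofIdx_smul, ofIdx_smul, smul_sub, smul_inv_smul, root_weyl_smul,
    coroot'_weyl_smul_right, inv_inv, smul_comm]

theorem weyl_mul_ofIdx (w : P.weylGroup) (i : ι) : w * ofIdx P i = ofIdx P (w • i) * w := by
  rw [← conj_ofIdx, inv_mul_cancel_right]

@[simp] theorem ofIdx_mul_self (i : ι) : ofIdx P i * ofIdx P i = 1 := by
  rw [mul_eq_one_iff_eq_inv]
  exact Subtype.ext (RootPairing.Equiv.reflection_inv P i).symm

@[simp] theorem ofIdx_inv (i : ι) : (ofIdx P i)⁻¹ = ofIdx P i :=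
  Subtype.ext (RootPairing.Equiv.reflection_inv P i)

theorem ofIdx_smul_self (i : ι) : ofIdx P i • i = negIdx P i := ofIdx_smul_idx P i i

@[simp] theorem root_negIdx (i : ι) : P.root (negIdx P i) = -P.root i := by
  simp [negIdx]

@[simp] theorem coroot_negIdx (i : ι) : P.coroot (negIdx P i) = -P.coroot i := by
  simp [negIdx]

@[simp] theorem coroot'_negIdx (i : ι) (x : X) : P.coroot' (negIdx P i) x = -P.coroot' i x := by
  change P.toLinearMap x (P.coroot (negIdx P i)) = -(P.toLinearMap x (P.coroot i))
  rw [coroot_negIdx, map_neg]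

@[simp] theorem negIdx_negIdx (i : ι) : negIdx P (negIdx P i) = i := by
  apply P.root.injective; simp

theorem weyl_smul_negIdx (w : P.weylGroup) (i : ι) : w • negIdx P i = negIdx P (w • i) := by
  apply P.root.injective
  rw [root_weyl_smul, root_negIdx, root_negIdx, root_weyl_smul, smul_neg]

@[simp] theorem ofIdx_negIdx (i : ι) : ofIdx P (negIdx P i) = ofIdx P i := by
  rw [← ofIdx_smul_self, ← conj_ofIdx]; simp

theorem ofIdx_smul_negIdx (i : ι) : ofIdx P i • negIdx P i = i := by
  rw [weyl_smul_negIdx, ofIdx_smul_self, negIdx_negIdx]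

end WeylAction

section Length

variable {ι X Y : Type*} [AddCommGroup X] [AddCommGroup Y] {P : RootPairing ι ℤ X Y} (b : P.Base)

theorem isPos_negIdx (i : ι) : b.IsPos (negIdx P i) ↔ ¬ b.IsPos i :=
  RootPairing.Base.IsPos.neg_iff_not b i

variable [Finite ι] [P.IsReduced]

theorem isPos_simple_smul {i j : ι} (hi : i ∈ b.support) (h1 : j ≠ i) (h2 : j ≠ negIdx P i) :
    b.IsPos (ofIdx P i • j) ↔ b.IsPos j := by
  rw [ofIdx_smul_idx]
  refine ⟨fun h => ?_, fun h => h.reflectionPerm hi h1⟩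
  rw [← P.reflectionPerm_self i j]
  refine h.reflectionPerm hi fun h3 => h2 ?_
  rw [← P.reflectionPerm_self i j, h3, negIdx]

theorem exists_word (w : P.weylGroup) : ∃ L : List ι, (∀ i ∈ L, i ∈ b.support) ∧
    (L.map (ofIdx P)).prod = w := by
  -- every reflection is conjugate to a simple one by a product of simple ones
  have key : ∀ j, ∃ L : List ι, (∀ i ∈ L, i ∈ b.support) ∧ (L.map (ofIdx P)).prod = ofIdx P j := by
    intro j
    induction j using b.induction_reflect with
    | h₀ i ih =>
      change ∃ L : List ι, _ ∧ _ = ofIdx P (negIdx P i)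
      rwa [ofIdx_negIdx]
    | h₁ i hi => exact ⟨[i], by simpa, by simp⟩
    | h₂ i j ih hj =>
      obtain ⟨L, h1, h2⟩ := ih
      refine ⟨j :: L ++ [j], by simpa [hj, or_imp, forall_and] using h1, ?_⟩
      rw [← ofIdx_smul_idx, ← conj_ofIdx]
      simp [h2, mul_assoc]
  obtain ⟨w, hw⟩ := w
  induction hw using RootPairing.weylGroup.induction with
  | mem i => exact key i
  | one => exact ⟨[], by simp, rfl⟩
  | mul x y hx hy ihx ihy =>
    obtain ⟨L, h1, h2⟩ := ihx
    obtain ⟨L', h3, h4⟩ := ihy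
    refine ⟨L ++ L', ?_, by rw [List.map_append, List.prod_append, h2, h4]; rfl⟩
    intro i hi
    rcases List.mem_append.1 hi with h | h
    exacts [h1 i h, h3 i h]

theorem exists_reduced_word (w : P.weylGroup) : ∃ L : List ι, (∀ i ∈ L, i ∈ b.support) ∧
    L.length = len b w ∧ (L.map (ofIdx P)).prod = w := by
  have : {n | ∃ L : List ι, (∀ i ∈ L, i ∈ b.support) ∧ L.length = n ∧
    (L.map (ofIdx P)).prod = w}.Nonempty := by
    obtain ⟨L, h1, h2⟩ := exists_word b w
    exact ⟨_, L, h1, rfl, h2⟩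
  exact Nat.sInf_mem this

omit [Finite ι] [P.IsReduced] in
theorem len_le_length {L : List ι} (hL : ∀ i ∈ L, i ∈ b.support) :
    len b (L.map (ofIdx P)).prod ≤ L.length :=
  Nat.sInf_le ⟨L, hL, rfl, rfl⟩

omit [Finite ι] [P.IsReduced] in
@[simp] theorem len_one : len b (1 : P.weylGroup) = 0 := by
  have := len_le_length b (P := P) (L := []) (by simp)
  simpa using this

theorem len_inv_le (w : P.weylGroup) : len b w⁻¹ ≤ len b w := by
  obtain ⟨L, h1, h2, h3⟩ := exists_reduced_word b w
  have := len_le_length b (L := L.reverse) (by simpa using h1)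
  rw [List.length_reverse, h2] at this
  convert this
  rw [← h3, List.prod_inv_reverse, List.map_map, List.map_reverse]
  congr 3
  funext i
  simp

@[simp] theorem len_inv (w : P.weylGroup) : len b w⁻¹ = len b w :=
  le_antisymm (len_inv_le b w) (by simpa using len_inv_le b w⁻¹)

theorem len_simple_mul_le {i : ι} (hi : i ∈ b.support) (w : P.weylGroup) :
    len b (ofIdx P i * w) ≤ len b w + 1 := by
  obtain ⟨L, h1, h2, h3⟩ := exists_reduced_word b w
  have := len_le_length b (L := i :: L) (by simpa [hi] using h1)
  simpa [h2, h3] using this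

/-- The deletion condition, for the product of a word with a reflection whose positive root is sent
to a negative root. -/
theorem exists_deletion {L : List ι} (hL : ∀ i ∈ L, i ∈ b.support) {j : ι} (hj : b.IsPos j)
    (h : ¬ b.IsPos ((L.map (ofIdx P)).prod • j)) :
    ∃ L' : List ι, (∀ i ∈ L', i ∈ b.support) ∧ L'.length + 1 = L.length ∧
      (L'.map (ofIdx P)).prod = (L.map (ofIdx P)).prod * ofIdx P j := by
  induction L with
  | nil => simp [hj] at h
  | cons i L ih =>
    have hL' : ∀ i ∈ L, i ∈ b.support := fun k hk => hL k (by simp [hk])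
    have hi : i ∈ b.support := hL i (by simp)
    by_cases h1 : b.IsPos ((L.map (ofIdx P)).prod • j)
    -- the letter `i` makes a positive root negative: this root is simple, and `i` can be dropped
    · refine ⟨L, hL', by simp, ?_⟩
      have h2 : (L.map (ofIdx P)).prod • j = i := by
        by_contra h2
        rw [List.map_cons, List.prod_cons, mul_smul, isPos_simple_smul b hi h2] at h
        · exact h h1
        · intro h3
          rw [h3, isPos_negIdx] at h1
          exact h1 (b.isPos_of_mem_support hi)
      rw [List.map_cons, List.prod_cons, mul_assoc, weyl_mul_ofIdx, h2, ← mul_assoc,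
        ofIdx_mul_self, one_mul]
    · obtain ⟨L', h2, h3, h4⟩ := ih hL' h1
      refine ⟨i :: L', by simpa [hi] using h2, by simp [h3], ?_⟩
      simp [h4, mul_assoc]

theorem len_mul_ofIdx_lt {j : ι} (hj : b.IsPos j) {w : P.weylGroup} (h : ¬ b.IsPos (w • j)) :
    len b (w * ofIdx P j) < len b w := by
  obtain ⟨L, h1, h2, rfl⟩ := exists_reduced_word b w
  obtain ⟨L', h3, h4, h5⟩ := exists_deletion b h1 hj h
  have := len_le_length b h3
  rw [h5] at this
  omega

theorem lt_len_mul_ofIdx {j : ι} (hj : b.IsPos j) {w : P.weylGroup} (h : b.IsPos (w • j)) :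
    len b w < len b (w * ofIdx P j) := by
  have := len_mul_ofIdx_lt b hj (w := w * ofIdx P j)
    (by rwa [mul_smul, ofIdx_smul_self, weyl_smul_negIdx, isPos_negIdx, not_not])
  rwa [mul_assoc, ofIdx_mul_self, mul_one] at this

/-- Passing from `w` to `w s_j` lowers the length exactly if `w` changes the sign of the root
`j`. -/
theorem len_mul_ofIdx_lt_iff (j : ι) (w : P.weylGroup) :
    len b (w * ofIdx P j) < len b w ↔ (b.IsPos j ↔ ¬ b.IsPos (w • j)) := by
  wlog hj : b.IsPos j generalizing j
  · have h1 := this (negIdx P j) (by rwa [isPos_negIdx])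
    rw [ofIdx_negIdx, weyl_smul_negIdx, isPos_negIdx, isPos_negIdx] at h1
    rw [h1]; tauto
  by_cases h : b.IsPos (w • j)
  · simp only [hj, h, not_true, iff_false, not_lt]
    exact (lt_len_mul_ofIdx b hj h).le
  · simp only [hj, h, not_false_iff, iff_true]
    exact len_mul_ofIdx_lt b hj h

omit [Finite ι] [P.IsReduced] in
theorem BruhatLT.len_lt {u w : P.weylGroup} (h : BruhatLT b u w) : len b u < len b w := by
  induction h with
  | single h => obtain ⟨_, _, h⟩ := h; exact h
  | tail _ h ih => obtain ⟨_, _, h⟩ := h; exact ih.trans h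

theorem bruhatLT_mul_ofIdx_iff (j : ι) (w : P.weylGroup) :
    BruhatLT b (w * ofIdx P j) w ↔ (b.IsPos j ↔ ¬ b.IsPos (w • j)) := by
  rw [← len_mul_ofIdx_lt_iff]
  refine ⟨BruhatLT.len_lt b, fun h => .single ⟨j, ?_, h⟩⟩
  rw [mul_assoc, ofIdx_mul_self, mul_one]

theorem len_simple_mul_of_pos {i : ι} (hi : i ∈ b.support) {w : P.weylGroup}
    (h : b.IsPos (w⁻¹ • i)) : len b (ofIdx P i * w) = len b w + 1 := by
  have h1 := lt_len_mul_ofIdx b (b.isPos_of_mem_support hi) h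
  rw [← len_inv b (w⁻¹ * _), mul_inv_rev, inv_inv, ofIdx_inv, len_inv] at h1
  have := len_simple_mul_le b hi w
  omega

theorem len_simple_mul_of_neg {i : ι} (hi : i ∈ b.support) {w : P.weylGroup}
    (h : ¬ b.IsPos (w⁻¹ • i)) : len b w = len b (ofIdx P i * w) + 1 := by
  have h1 := len_simple_mul_of_pos b hi (w := ofIdx P i * w)
    (by rwa [mul_inv_rev, mul_smul, ofIdx_inv, ofIdx_smul_self, weyl_smul_negIdx, isPos_negIdx])
  rwa [← mul_assoc, ofIdx_mul_self, one_mul] at h1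

/-- A root is positive exactly if its coroot is a positive combination of the simple coroots, since
a simple reflection changes only the signs of its own root and coroot. -/
theorem isPos_iff_isPos_flip (i : ι) : b.IsPos i ↔ b.flip.IsPos i := by
  have : Module.IsReflexive ℤ Y := Module.IsReflexive.of_isPerfPair P.toLinearMap.flip
  have : Module.IsReflexive ℤ X := Module.IsReflexive.of_isPerfPair P.toLinearMap
  have : P.flip.IsReduced := RootPairing.instFlipIsReduced P
  have hneg : ∀ i, b.flip.IsPos (negIdx P i) ↔ ¬ b.flip.IsPos i :=
    fun i => RootPairing.Base.IsPos.neg_iff_not b.flip i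
  induction i using b.induction_reflect with
  | h₀ i ih => exact (isPos_negIdx b i).trans ((not_congr ih).trans (hneg i).symm)
  | h₁ i hi => exact iff_of_true (b.isPos_of_mem_support hi) (b.flip.isPos_of_mem_support hi)
  | h₂ i j ih hj =>
    by_cases h1 : i = j
    · subst h1
      exact (isPos_negIdx b i).trans ((not_congr ih).trans (hneg i).symm)
    by_cases h2 : i = negIdx P j
    · subst h2
      have : P.reflectionPerm j (negIdx P j) = j := P.reflectionPerm_self j j
      rw [this]
      exact iff_of_true (b.isPos_of_mem_support hj) (b.flip.isPos_of_mem_support hj)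
    rw [← ofIdx_smul_idx, isPos_simple_smul b hj h1 h2, ofIdx_smul_idx]
    refine Iff.trans ih ?_
    refine ⟨fun h => h.reflectionPerm (b := b.flip) hj h1, fun h => ?_⟩
    rw [← P.reflectionPerm_self j i]
    refine h.reflectionPerm (b := b.flip) hj fun h3 => h2 ?_
    rw [← P.reflectionPerm_self j i, h3, negIdx]

end Length

section Parity

variable {ι X Y : Type*} [AddCommGroup X] [AddCommGroup Y] {P : RootPairing ι ℤ X Y} (b : P.Base)

theorem finite_coweight [Finite ι] (hsc : Submodule.span ℤ (Set.range P.coroot) = ⊤) :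
    Module.Finite ℤ Y :=
  ⟨⟨(Set.finite_range P.coroot).toFinset, by simpa using hsc⟩⟩

theorem free_finite_weight (P : RootPairing ι ℤ X Y) [Module.Finite ℤ Y] :
    Module.Free ℤ X ∧ Module.Finite ℤ X := by
  have : Module.IsReflexive ℤ X := Module.IsReflexive.of_isPerfPair P.toLinearMap
  have : Module.IsReflexive ℤ Y := Module.IsReflexive.of_isPerfPair P.toLinearMap.flip
  have : Module.Finite ℤ X := Module.Finite.equiv P.toPerfPair.symm
  exact ⟨inferInstance, this⟩

theorem det_weyl_reflection [Module.Finite ℤ Y] (i : ι) :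
    LinearEquiv.det (RootPairing.Equiv.weightHom P (ofIdx P i : P.Aut)) = -1 := by
  obtain ⟨_, _⟩ := free_finite_weight P
  ext
  rw [LinearEquiv.coe_det]
  have : ((RootPairing.Equiv.weightHom P (ofIdx P i : P.Aut) : X ≃ₗ[ℤ] X) : X →ₗ[ℤ] X) =
      LinearMap.transvection (-(P.coroot' i)) (P.root i) := by
    ext x
    rw [LinearMap.transvection.apply]
    refine (ofIdx_smul P i x).trans ?_
    simp [sub_eq_add_neg]
  rw [this, LinearMap.transvection.det, LinearMap.neg_apply, RootPairing.root_coroot'_eq_pairing,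
    RootPairing.pairing_same]
  rfl

/-- The sign character of the Weyl group, computed on a reduced word. -/
theorem det_weyl [Finite ι] [P.IsReduced] [Module.Finite ℤ Y] (w : P.weylGroup) :
    LinearEquiv.det (RootPairing.Equiv.weightHom P (w : P.Aut)) = (-1) ^ len b w := by
  obtain ⟨L, h1, h2, h3⟩ := exists_reduced_word b w
  rw [← h2, ← h3]
  clear h1 h2 h3
  induction L with
  | nil =>
    change LinearEquiv.det (RootPairing.Equiv.weightHom P 1) = 1
    rw [map_one, map_one]
  | cons i L ih =>
    rw [List.map_cons, List.prod_cons, Subgroup.coe_mul, map_mul, map_mul, ih,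
      det_weyl_reflection, List.length_cons, pow_succ']

theorem len_mul_ofIdx_parity [Finite ι] [P.IsReduced] [Module.Finite ℤ Y] (w : P.weylGroup)
    (i : ι) : Even (len b w + len b (w * ofIdx P i) + 1) := by
  have h := det_weyl b (w * ofIdx P i)
  rw [Subgroup.coe_mul, map_mul, map_mul, det_weyl b w, det_weyl_reflection] at h
  rw [← neg_one_pow_eq_one_iff_even (R := ℤˣ) (by decide), pow_add, pow_add, ← h, pow_one,
    mul_neg_one, mul_neg, mul_neg, neg_neg, mul_one, ← pow_add, ← two_mul, pow_mul]
  simp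

end Parity

/-! ### Signed sums along a string of weights -/

section StringSum

variable {A : Type*} [AddCommGroup A]

/-- The signed sum `-∑_{0 < k ≤ m} f k` if `m ≥ 0`, and `∑_{m < k ≤ 0} f k` if `m < 0`. It is
written with the half-open ranges of `divDiff`, to which it is thereby linked. -/
def stringSum (m : ℤ) (f : ℤ → A) : A :=
  (if 0 ≤ m then -∑ k ∈ Finset.range m.toNat, f k
    else ∑ k ∈ Finset.range (-m).toNat, f (-(k + 1))) + f 0 - f m

@[simp] theorem stringSum_zero (f : ℤ → A) : stringSum 0 f = 0 := by simp [stringSum]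

theorem stringSum_add_one (m : ℤ) (f : ℤ → A) :
    stringSum (m + 1) f = stringSum m f - f (m + 1) := by
  unfold stringSum
  rcases lt_or_ge m 0 with h | h
  · obtain ⟨n, rfl⟩ : ∃ n : ℕ, m = -(n + 1 : ℤ) := ⟨(-m - 1).toNat, by omega⟩
    have e1 : (-(-(n + 1 : ℤ))).toNat = n + 1 := by omega
    have e2 : (-(-(n + 1 : ℤ) + 1)).toNat = n := by omega
    rw [if_neg (show ¬ 0 ≤ -(n + 1 : ℤ) by omega), e1, Finset.sum_range_succ]
    by_cases hn : n = 0
    · subst hn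
      simp
    · rw [if_neg (show ¬ 0 ≤ -(n + 1 : ℤ) + 1 by omega), e2]
      abel
  · obtain ⟨n, rfl⟩ := Int.eq_ofNat_of_zero_le h
    rw [if_pos (by omega), if_pos (by omega)]
    have e : ((n : ℤ) + 1).toNat = n + 1 := by omega
    rw [e, Int.toNat_natCast, Finset.sum_range_succ]
    abel

theorem stringSum_sub_one (m : ℤ) (f : ℤ → A) :
    stringSum (m - 1) f = stringSum m f + f m := by
  have := stringSum_add_one (m - 1) f
  rw [sub_add_cancel] at this
  rw [this, sub_add_cancel]

@[simp] theorem stringSum_neg_one (f : ℤ → A) : stringSum (-1) f = f 0 := by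
  simpa using stringSum_sub_one 0 f

theorem stringSum_add (n m : ℤ) (f : ℤ → A) :
    stringSum (n + m) f = stringSum n f + stringSum m (fun k => f (k + n)) := by
  induction m using Int.induction_on with
  | zero => simp
  | succ m ih =>
    rw [← add_assoc, stringSum_add_one, ih, stringSum_add_one, add_sub_assoc]
    congr 3
    ring
  | pred m ih =>
    rw [← add_sub_assoc, stringSum_sub_one, ih, stringSum_sub_one, add_assoc]
    congr 3
    ring

theorem map_stringSum {A' F : Type*} [AddCommGroup A'] [FunLike F A A'] [AddMonoidHomClass F A A']
    (φ : F) (m : ℤ) (f : ℤ → A) : φ (stringSum m f) = stringSum m (fun k => φ (f k)) := by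
  unfold stringSum
  split_ifs <;> simp [map_sum]

theorem stringSum_add_fun (m : ℤ) (f g : ℤ → A) :
    stringSum m (fun k => f k + g k) = stringSum m f + stringSum m g := by
  unfold stringSum
  split_ifs <;> rw [Finset.sum_add_distrib] <;> beta_reduce <;> abel

theorem stringSum_smul_fun {S : Type*} [CommRing S] [Module S A] (m : ℤ) (c : S) (f : ℤ → A) :
    stringSum m (fun k => c • f k) = c • stringSum m f :=
  (map_stringSum (LinearMap.lsmul S A c) m f).symm

theorem divDiff_eq_stringSum {ι X Y : Type*} [AddCommGroup X] [AddCommGroup Y]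
    (P : RootPairing ι ℤ X Y) (x : X → A) (i : ι) (lam : X) :
    divDiff P x i lam = stringSum (P.coroot' i lam) (fun k => x (lam - k • P.root i)) +
      x (P.reflection i lam) - x lam := by
  unfold divDiff stringSum
  rw [RootPairing.reflection_apply]
  split_ifs with h
  · simp
  · simp [sub_eq_add_neg, add_smul]

end StringSum

/-! ### The alcove module and its operators -/

section Operators

variable {ι X Y : Type*} [AddCommGroup X] [AddCommGroup Y] {P : RootPairing ι ℤ X Y} (b : P.Base)
  {S : Type*} [CommRing S]

/-- The basis vector of `(W × X) →₀ S` attached to the element `x ↦ ν + w x` of the extended affine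
Weyl group. -/
def ket (S : Type*) [CommRing S] (w : P.weylGroup) (nu : X) : (P.weylGroup × X) →₀ S :=
  Finsupp.single (w, nu) 1

/-- The linear operator with the given values on the basis vectors. -/
def ofKet (f : P.weylGroup → X → (P.weylGroup × X) →₀ S) :
    Module.End S ((P.weylGroup × X) →₀ S) :=
  Finsupp.linearCombination S (fun g => f g.1 g.2)

@[simp] theorem ofKet_ket (f : P.weylGroup → X → (P.weylGroup × X) →₀ S) (w : P.weylGroup)
    (nu : X) : ofKet f (ket S w nu) = f w nu := by
  simp [ofKet, ket]

theorem end_ext {f g : Module.End S ((P.weylGroup × X) →₀ S)}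
    (h : ∀ w nu, f (ket S w nu) = g (ket S w nu)) : f = g := by
  apply Finsupp.lhom_ext'
  rintro ⟨w, nu⟩
  ext1
  exact h w nu

/-- The operator of `q^{1/2} T_s⁻¹`, for `s` the reflection in the root of index `i`, twisted by a
position `p`: the integers `p γ` are the integral parts of the coroots at a point `x` of an alcove.
The integer `⟨ν, α^∨⟩ + p (w⁻¹ α)` locates the alcove of `ν + w x` among the hyperplanes parallel
to that of `α`. -/
def tauOp (z : S) (p : ι → ℤ) (i : ι) : Module.End S ((P.weylGroup × X) →₀ S) :=
  ofKet fun w nu => ket S (ofIdx P i * w) (ofIdx P i • nu) +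
    z • stringSum (P.coroot' i nu + p (w⁻¹ • i)) (fun k => ket S w (nu - k • P.root i))

open Classical in
/-- The sign with which an alcove `w` folds at a hyperplane of the root `j`; it is zero where no
folding is allowed. -/
def foldSign (S : Type*) [CommRing S] (j : ι) (w : P.weylGroup) : S :=
  if BruhatLT b (w * ofIdx P j) w then (if b.IsPos j then 1 else -1) else 0

/-- The operator attached to the crossing of the hyperplane `H_{-β, d}`: the sum of the crossing
and, where it is allowed, of the folding. -/
def foldOp (z : S) (j : ι) (d : ℤ) : Module.End S ((P.weylGroup × X) →₀ S) :=
  ofKet fun w nu => ket S w nu +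
    (foldSign b S j w * z) • ket S (w * ofIdx P j) (nu - d • P.root (w • j))

/-- Right multiplication by the translation by `x`. -/
def transOp (x : X) : Module.End S ((P.weylGroup × X) →₀ S) :=
  ofKet fun w nu => ket S w (nu + w • x)

/-- Right multiplication by `u`. -/
def rightOp (u : P.weylGroup) : Module.End S ((P.weylGroup × X) →₀ S) :=
  ofKet fun w nu => ket S (w * u) nu

/-- Left multiplication by the translation by `x`. -/
def leftOp (x : X) : Module.End S ((P.weylGroup × X) →₀ S) :=
  ofKet fun w nu => ket S w (x + nu)

/-- Positions `p` and `p'` of two adjacent alcoves, where the step from the first to the second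
crosses the hyperplane `H_{-β, d}` in the direction of `-β`. The last condition says that the
reflection in this hyperplane takes the first alcove to the second. -/
structure Step (P : RootPairing ι ℤ X Y) (p p' : ι → ℤ) (j : ι) (d : ℤ) : Prop where
  off : ∀ γ, γ ≠ j → γ ≠ negIdx P j → p' γ = p γ
  left_neg : p (negIdx P j) = d - 1
  right_neg : p' (negIdx P j) = d
  left_self : p j = -d
  right_self : p' j = -d - 1
  refl : ∀ γ, p' (ofIdx P j • γ) = p γ + d * P.coroot' γ (P.root j)

theorem tauOp_comp_transOp (z : S) (p : ι → ℤ) (i : ι) (x : X) :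
    tauOp z p i * transOp (P := P) x =
      transOp x * tauOp z (fun γ => p γ + P.coroot' γ x) i := by
  apply end_ext
  intro w nu
  simp only [tauOp, transOp, Module.End.mul_apply, ofKet_ket, map_add, map_smul, map_stringSum,
    smul_add, mul_smul, coroot'_weyl_smul_right]
  congr 3
  · ring
  · funext k
    congr 1
    abel

theorem tauOp_comp_rightOp (z : S) (p : ι → ℤ) (i : ι) (u : P.weylGroup) :
    tauOp z p i * rightOp u = rightOp u * tauOp z (fun γ => p (u⁻¹ • γ)) i := by
  apply end_ext
  intro w nu
  simp only [tauOp, rightOp, Module.End.mul_apply, ofKet_ket, map_add, map_smul, map_stringSum,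
    mul_inv_rev, mul_smul, mul_assoc]

/-- The relation of Bernstein and Lusztig. -/
theorem tauOp_comp_leftOp (z : S) (p : ι → ℤ) (i : ι) (x : X) :
    tauOp z p i * leftOp (P := P) x = leftOp (ofIdx P i • x) * tauOp z p i +
      z • stringSum (A := Module.End S ((P.weylGroup × X) →₀ S)) (P.coroot' i x)
        (fun k => leftOp (x - k • P.root i)) := by
  apply end_ext
  intro w nu
  have e : ∀ (m : ℤ) (f : ℤ → Module.End S ((P.weylGroup × X) →₀ S)),
      stringSum m f (ket S w nu) = stringSum m (fun k => f k (ket S w nu)) := fun m f =>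
    map_stringSum (LinearMap.applyₗ (R := S) (ket S w nu)) m f
  simp only [LinearMap.add_apply, LinearMap.smul_apply, e]
  simp only [tauOp, leftOp, Module.End.mul_apply, ofKet_ket, map_add, map_smul, map_stringSum,
    smul_add]
  rw [add_assoc (P.coroot' i x), stringSum_add, smul_add, add_assoc]
  congr 1
  rw [add_comm]
  congr 3
  · funext k
    congr 1
    rw [ofIdx_smul, add_smul]
    abel
  · funext k
    congr 1
    abel

variable [Finite ι] [P.IsReduced]

open Classical in
/-- The sign depends only on the signs of `β` and `w β`. This makes it jump by one when `w` is
replaced by `s w`, for `s` the simple reflection in `± w β`, and leaves it unchanged for the other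
simple reflections. -/
theorem foldSign_eq (j : ι) (w : P.weylGroup) :
    foldSign b S j w = if b.IsPos j then (if b.IsPos (w • j) then 0 else 1)
      else (if b.IsPos (w • j) then -1 else 0) := by
  unfold foldSign
  rw [if_congr (bruhatLT_mul_ofIdx_iff b j w) rfl rfl]
  by_cases h1 : b.IsPos j <;> by_cases h2 : b.IsPos (w • j) <;> simp [h1, h2]

/-- Crossing a hyperplane intertwines the actions of the simple generators twisted by the positions
before and after the crossing. -/
theorem tauOp_comp_foldOp (z : S) {p p' : ι → ℤ} {j : ι} {d : ℤ} (h : Step P p p' j d) {i : ι}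
    (hi : i ∈ b.support) : tauOp z p' i * foldOp b z j d = foldOp b z j d * tauOp z p i := by
  have hpos := b.isPos_of_mem_support hi
  have hneg : ¬ b.IsPos (negIdx P i) := by rwa [isPos_negIdx, not_not]
  apply end_ext
  intro w nu
  simp only [tauOp, foldOp, Module.End.mul_apply, ofKet_ket, map_add, map_smul, map_stringSum,
    stringSum_add_fun, stringSum_smul_fun, smul_add, mul_inv_rev, mul_smul, ofIdx_inv]
  -- if `w β = ± α`, the string of weights gets longer or shorter by one, which makes up for the
  -- change of `foldSign`
  by_cases h1 : w • j = negIdx P i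
  · have ha : w⁻¹ • i = negIdx P j := by
      rw [inv_smul_eq_iff, weyl_smul_negIdx, h1, negIdx_negIdx]
    have e1 : w * ofIdx P j = ofIdx P i * w := by
      rw [weyl_mul_ofIdx, h1, ofIdx_negIdx]
    have e2 : (foldSign b S j w : S) = foldSign b S j (ofIdx P i * w) + 1 := by
      rw [foldSign_eq, foldSign_eq, mul_smul, h1, ofIdx_smul_negIdx]
      by_cases hj : b.IsPos j <;> simp [hj, hpos, hneg]
    have e3 : ofIdx P i * w * ofIdx P j = w := by
      rw [mul_assoc, e1, ← mul_assoc, ofIdx_mul_self, one_mul]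
    rw [e3, ha, h1, ofIdx_smul_negIdx, h.left_neg, ofIdx_smul_negIdx, h.right_self, h.right_neg, e1,
      ← mul_assoc, ofIdx_mul_self, one_mul, root_negIdx]
    have e4 : P.coroot' i (nu - d • -P.root i) + (-d - 1) = P.coroot' i nu + (d - 1) := by
      rw [map_sub, map_smul, map_neg, RootPairing.root_coroot'_eq_pairing,
        RootPairing.pairing_same]
      simp only [smul_eq_mul]
      ring
    have e5 : ofIdx P i • (nu - d • -P.root i) = ofIdx P i • nu - d • P.root i := by
      rw [smul_sub, smul_comm, smul_neg, ← root_weyl_smul, ofIdx_smul_self, root_negIdx, neg_neg]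
    have e6 : ofIdx P i • nu - d • P.root i = nu - (P.coroot' i nu + d) • P.root i := by
      rw [ofIdx_smul, add_smul]; abel
    have e7 : stringSum (P.coroot' i nu + (d - 1)) (fun k => ket S w (nu - k • P.root i)) =
        stringSum (P.coroot' i nu + d) (fun k => ket S w (nu - k • P.root i)) +
          ket S w (nu - (P.coroot' i nu + d) • P.root i) := by
      rw [← add_sub_assoc, stringSum_sub_one]
    have e8 : ∀ k : ℤ, nu - k • P.root i - d • -P.root i = nu - d • -P.root i - k • P.root i :=
      fun k => by abel
    simp only [e4, e5, e6, e7, e8, e2]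
    module
  by_cases h2 : w • j = i
  · have ha : w⁻¹ • i = j := by rw [inv_smul_eq_iff, h2]
    have e1 : w * ofIdx P j = ofIdx P i * w := by rw [weyl_mul_ofIdx, h2]
    have e2 : (foldSign b S j (ofIdx P i * w) : S) = foldSign b S j w + 1 := by
      rw [foldSign_eq, foldSign_eq, mul_smul, h2, ofIdx_smul_self]
      by_cases hj : b.IsPos j <;> simp [hj, hpos, hneg]
    have e3 : ofIdx P i * w * ofIdx P j = w := by
      rw [mul_assoc, e1, ← mul_assoc, ofIdx_mul_self, one_mul]
    rw [e3, ha, h2, ofIdx_smul_self, h.left_self, ofIdx_smul_self, h.right_neg, h.right_self, e1,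
      ← mul_assoc, ofIdx_mul_self, one_mul, root_negIdx]
    have e4 : P.coroot' i (nu - d • P.root i) + d = P.coroot' i nu + -d := by
      rw [map_sub, map_smul, RootPairing.root_coroot'_eq_pairing,
        RootPairing.pairing_same]
      simp only [smul_eq_mul]
      ring
    have e5 : ofIdx P i • (nu - d • P.root i) = ofIdx P i • nu - d • -P.root i := by
      rw [smul_sub, smul_comm, ← root_weyl_smul, ofIdx_smul_self, root_negIdx]
    have e6 : ofIdx P i • nu - d • -P.root i = nu - (P.coroot' i nu + -d) • P.root i := by
      rw [ofIdx_smul, add_smul]; module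
    have e7 : stringSum (P.coroot' i nu + (-d - 1)) (fun k => ket S w (nu - k • P.root i)) =
        stringSum (P.coroot' i nu + -d) (fun k => ket S w (nu - k • P.root i)) +
          ket S w (nu - (P.coroot' i nu + -d) • P.root i) := by
      rw [← add_sub_assoc, stringSum_sub_one]
    have e8 : ∀ k : ℤ, nu - k • P.root i - d • P.root i = nu - d • P.root i - k • P.root i :=
      fun k => by abel
    simp only [e4, e5, e6, e7, e8, e2]
    module
  -- otherwise the last condition in `Step` matches the strings of the folded terms
  · have ha1 : w⁻¹ • i ≠ j := fun h3 => h2 (by rw [← h3, smul_inv_smul])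
    have ha2 : w⁻¹ • i ≠ negIdx P j := fun h3 => h1 (by
      rw [inv_smul_eq_iff, weyl_smul_negIdx] at h3
      rw [h3, negIdx_negIdx])
    have e2 : (foldSign b S j (ofIdx P i * w) : S) = foldSign b S j w := by
      rw [foldSign_eq, foldSign_eq, mul_smul, isPos_simple_smul b hi h2 h1]
    have e4 : P.coroot' i (nu - d • P.root (w • j)) + p' (ofIdx P j • w⁻¹ • i) =
        P.coroot' i nu + p (w⁻¹ • i) := by
      rw [h.refl, map_sub, map_smul, root_weyl_smul, coroot'_weyl_smul_right, smul_eq_mul]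
      ring
    have e5 : ofIdx P i • (nu - d • P.root (w • j)) =
        ofIdx P i • nu - d • P.root (ofIdx P i • w • j) := by
      rw [smul_sub, smul_comm, ← root_weyl_smul]
    have e8 : ∀ k : ℤ, nu - k • P.root i - d • P.root (w • j) =
        nu - d • P.root (w • j) - k • P.root i :=
      fun k => by abel
    simp only [e4, e5, e8, e2, h.off _ ha1 ha2, mul_assoc]
    module

/-! ### Paths -/

/-- The operator of a path, given as the list of its crossings. -/
def pathOp (z : S) : List (ι × ℤ) → Module.End S ((P.weylGroup × X) →₀ S)
  | [] => 1
  | c :: L => pathOp z L * foldOp b z c.1 c.2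

/-- A list of successive crossings leading from one position to another. -/
inductive StepPath (P : RootPairing ι ℤ X Y) : (ι → ℤ) → List (ι × ℤ) → (ι → ℤ) → Prop
  | nil (p : ι → ℤ) : StepPath P p [] p
  | cons {p p' p'' : ι → ℤ} {j : ι} {d : ℤ} {L : List (ι × ℤ)} (h : Step P p p' j d)
      (hL : StepPath P p' L p'') : StepPath P p ((j, d) :: L) p''

omit [Finite ι] [P.IsReduced] in
theorem StepPath.append {p p' p'' : ι → ℤ} {L L' : List (ι × ℤ)} (h : StepPath P p L p')
    (h' : StepPath P p' L' p'') : StepPath P p (L ++ L') p'' := by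
  induction h with
  | nil p => exact h'
  | cons h _ ih => exact .cons h (ih h')

theorem tauOp_comp_pathOp (z : S) {p p' : ι → ℤ} {L : List (ι × ℤ)} (h : StepPath P p L p') {i : ι}
    (hi : i ∈ b.support) : tauOp z p' i * pathOp b z L = pathOp b z L * tauOp z p i := by
  induction h with
  | nil p => simp [pathOp]
  | cons h _ ih => rw [pathOp, ← mul_assoc, ih, mul_assoc, tauOp_comp_foldOp b z h hi, mul_assoc]

/-- No folding is allowed at the identity. -/
theorem pathOp_ket_one (z : S) (L : List (ι × ℤ)) (nu : X) :
    pathOp b z L (ket S 1 nu) = ket S 1 nu := by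
  induction L with
  | nil => rfl
  | cons c L ih =>
    have : foldSign b S c.1 (1 : P.weylGroup) = 0 := by
      rw [foldSign_eq, one_smul]
      by_cases h : b.IsPos c.1 <;> simp [h]
    simp [pathOp, foldOp, this, ih]

open Classical in
/-- The position of the fundamental alcove. -/
def fundPos (γ : ι) : ℤ := if b.IsPos γ then 0 else -1

/-- The first step out of the fundamental alcove through a wall containing the origin. -/
theorem step_simple {j : ι} (hj : j ∈ b.support) :
    Step P (fundPos b) (fun γ => fundPos b (ofIdx P j • γ)) j 0 := by
  have hpos := b.isPos_of_mem_support hj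
  have hneg : ¬ b.IsPos (negIdx P j) := by rwa [isPos_negIdx, not_not]
  constructor
  · intro γ h1 h2
    by_cases h : b.IsPos γ <;> simp [fundPos, isPos_simple_smul b hj h1 h2, h]
  · simp [fundPos, hneg]
  · simp [ofIdx_smul_negIdx, fundPos, hpos]
  · simp [fundPos, hpos]
  · simp [ofIdx_smul_self, fundPos, hneg]
  · intro γ
    simp [← mul_smul]

theorem exists_mul_simple_len_lt {w : P.weylGroup} (hw : w ≠ 1) :
    ∃ j ∈ b.support, len b (w * ofIdx P j) < len b w := by
  obtain ⟨L, h1, h2, h3⟩ := exists_reduced_word b w⁻¹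
  rcases L with _ | ⟨j, L⟩
  · simp only [List.map_nil, List.prod_nil] at h3
    exact absurd (by simpa using h3.symm) hw
  · refine ⟨j, h1 j (by simp), ?_⟩
    have h4 := len_le_length b (P := P) (L := L) fun k hk => h1 k (by simp [hk])
    have h5 : (L.map (ofIdx P)).prod = ofIdx P j * w⁻¹ := by
      rw [← h3, List.map_cons, List.prod_cons, ← mul_assoc, ofIdx_mul_self, one_mul]
    rw [h5, ← len_inv, mul_inv_rev, inv_inv, ofIdx_inv] at h4
    rw [len_inv, List.length_cons] at h2
    omega

/-- Every basis vector is the image of the first one under an operator commuting with the simple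
generators: for a translation the operator of a path to the translated alcove, and for a larger `w`
the crossings of walls through the origin, one for each letter of a reduced word. -/
theorem exists_commuting_ket (z : S)
    (hpath : ∀ x : X, ∃ L, StepPath P (fundPos b) L (fun γ => fundPos b γ + P.coroot' γ x))
    (w : P.weylGroup) (nu : X) : ∃ f : Module.End S ((P.weylGroup × X) →₀ S),
      (∀ i ∈ b.support, Commute (tauOp z (fundPos b) i) f) ∧ f (ket S 1 0) = ket S w nu := by
  induction hn : len b w using Nat.strong_induction_on generalizing w with
  | _ n ih =>
    by_cases hw : w = 1
    · subst hw
      obtain ⟨L, hL⟩ := hpath nu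
      refine ⟨transOp nu * pathOp b z L, fun i hi => ?_, ?_⟩
      · rw [Commute, SemiconjBy, ← mul_assoc, tauOp_comp_transOp, mul_assoc,
          tauOp_comp_pathOp b z hL hi, mul_assoc]
      · rw [Module.End.mul_apply, pathOp_ket_one]
        simp [transOp]
    · obtain ⟨j, hj, hlt⟩ := exists_mul_simple_len_lt b hw
      obtain ⟨f, h1, h2⟩ := ih _ (hn ▸ hlt) (w * ofIdx P j) rfl
      refine ⟨rightOp (ofIdx P j) * foldOp b z j 0 * f, fun i hi => ?_, ?_⟩
      · refine Commute.mul_right ?_ (h1 i hi)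
        rw [Commute, SemiconjBy, ← mul_assoc, tauOp_comp_rightOp, mul_assoc, ofIdx_inv,
          tauOp_comp_foldOp b z (step_simple b hj) hi, mul_assoc]
      -- lengthening an element is not a folding
      · have h3 : foldSign b S j (w * ofIdx P j) = 0 := by
          unfold foldSign
          rw [if_neg]
          intro h3
          have h4 := h3.len_lt
          rw [mul_assoc, ofIdx_mul_self, mul_one] at h4
          omega
        simp [Module.End.mul_apply, h2, foldOp, rightOp, h3, mul_assoc]

end Operators

/-! ### Existence of paths: generic lines -/

/-- A continuous function without integral values on a connected set has a constant integral
part. -/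
theorem floor_eq_of_isPreconnected {α : Type*} [TopologicalSpace α] {U : Set α}
    (hU : IsPreconnected U) {f : α → ℝ} (hf : ContinuousOn f U) (h : ∀ x ∈ U, ∀ k : ℤ, f x ≠ k)
    {x y : α} (hx : x ∈ U) (hy : y ∈ U) : ⌊f x⌋ = ⌊f y⌋ := by
  wlog hlt : ⌊f x⌋ < ⌊f y⌋ generalizing x y
  · rcases lt_trichotomy ⌊f x⌋ ⌊f y⌋ with h1 | h1 | h1
    exacts [this hx hy h1, h1, (this hy hx h1).symm]
  have h1 : f x < ⌊f y⌋ := Int.floor_lt.1 hlt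
  obtain ⟨t, ht, hft⟩ := hU.intermediate_value hx hy hf ⟨h1.le, Int.floor_le (f y)⟩
  exact absurd hft (h t ht _)

section Path

variable {ι X Y : Type*} [AddCommGroup X] [AddCommGroup Y] (P : RootPairing ι ℤ X Y)

theorem coroot_ofIdx_smul (i j : ι) :
    P.coroot (ofIdx P i • j) = P.coroot j - P.coroot' j (P.root i) • P.coroot i := by
  rw [ofIdx_smul_idx, RootPairing.coroot_reflectionPerm, RootPairing.coreflection_apply_coroot]
  rfl

theorem coroot'_ofIdx_smul_idx (i j : ι) (x : X) :
    P.coroot' (ofIdx P i • j) x = P.coroot' j x - P.coroot' j (P.root i) * P.coroot' i x := by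
  have h := coroot'_weyl_smul_right P (ofIdx P i) j x
  rw [ofIdx_inv] at h
  rw [← h, ofIdx_smul, map_sub, map_smul, smul_eq_mul, mul_comm]

theorem eq_or_eq_negIdx_of_smul_coroot [Finite ι] [P.IsReduced] {i j : ι} {m n : ℤ} (hm : m ≠ 0)
    (h : m • P.coroot i = n • P.coroot j) : i = j ∨ i = negIdx P j := by
  have : Module.IsReflexive ℤ Y := Module.IsReflexive.of_isPerfPair P.toLinearMap.flip
  have : Module.IsReflexive ℤ X := Module.IsReflexive.of_isPerfPair P.toLinearMap
  have : P.flip.IsReduced := RootPairing.instFlipIsReduced P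
  have h1 : ¬ LinearIndependent ℤ ![P.flip.root i, P.flip.root j] := by
    rw [LinearIndependent.pair_iff]
    intro h2
    refine hm (h2 m (-n) ?_).1
    change m • P.coroot i + (-n) • P.coroot j = 0
    rw [h, neg_smul, add_neg_cancel]
  rcases RootPairing.IsReduced.eq_or_eq_neg i j h1 with h2 | h2
  · exact .inl (P.coroot.injective h2)
  · exact .inr (P.coroot_eq_neg_iff.1 h2)

theorem coroot'_root_self (i : ι) : P.coroot' i (P.root i) = 2 :=
  (P.root_coroot'_eq_pairing i i).trans (P.pairing_same i)

/-- For the roots `±β` the last condition in `Step` follows from the others. -/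
theorem Step.of_off {p p' : ι → ℤ} {j : ι} {d : ℤ}
    (off : ∀ γ, γ ≠ j → γ ≠ negIdx P j → p' γ = p γ)
    (left_neg : p (negIdx P j) = d - 1) (right_neg : p' (negIdx P j) = d)
    (left_self : p j = -d) (right_self : p' j = -d - 1)
    (refl : ∀ γ, γ ≠ j → γ ≠ negIdx P j →
      p' (ofIdx P j • γ) = p γ + d * P.coroot' γ (P.root j)) : Step P p p' j d := by
  refine ⟨off, left_neg, right_neg, left_self, right_self, fun γ => ?_⟩
  by_cases h1 : γ = j
  · rw [h1, ofIdx_smul_self, right_neg, left_self, coroot'_root_self]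
    ring
  by_cases h2 : γ = negIdx P j
  · rw [h2, ofIdx_smul_negIdx, right_self, left_neg, coroot'_negIdx, coroot'_root_self]
    ring
  exact refl γ h1 h2

theorem ofIdx_smul_ne {j γ : ι} (h1 : γ ≠ j) (h2 : γ ≠ negIdx P j) :
    ofIdx P j • γ ≠ j ∧ ofIdx P j • γ ≠ negIdx P j := by
  constructor
  · intro h
    apply h2
    rw [← ofIdx_smul_self, ← inv_smul_eq_iff, ofIdx_inv, h]
  · intro h
    apply h1
    rw [← ofIdx_smul_self] at h
    exact smul_left_cancel _ h

variable [Finite ι] [P.IsReduced]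

/-- A line in a generic position crosses the hyperplanes one at a time. Here `e` is a point at which
no nonzero element of `Y` takes an integral value, and the line leads from `e` to `e + x`. -/
theorem exists_stepPath_of_generic {e : Y →ₗ[ℤ] ℝ} (he : ∀ (y : Y) (k : ℤ), e y = k → y = 0)
    (x : X) : ∃ L, StepPath P (fun γ => ⌊e (P.coroot γ)⌋) L
      (fun γ => ⌊e (P.coroot γ)⌋ + P.coroot' γ x) := by
  set val : ℝ → ι → ℝ := fun s γ => e (P.coroot γ) + s * (P.coroot' γ x : ℝ) with hval
  have hne : ∀ (s : ℝ) (γ : ι) (k : ℤ), val s γ = k → P.coroot' γ x ≠ 0 := by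
    intro s γ k h1 h2
    simp only [hval, h2, Int.cast_zero, mul_zero, add_zero] at h1
    exact P.ne_zero' γ (he _ _ h1)
  have huniq : ∀ (c : ℝ) (γ δ : ι) (k d : ℤ), val c γ = k → val c δ = d →
      γ = δ ∨ γ = negIdx P δ := by
    intro c γ δ k d h1 h2
    refine eq_or_eq_negIdx_of_smul_coroot P (hne _ _ _ h2) (n := P.coroot' γ x) ?_
    rw [← sub_eq_zero]
    refine he _ (P.coroot' δ x * k - P.coroot' γ x * d) ?_
    rw [map_sub, map_zsmul, map_zsmul]
    push_cast
    rw [← h1, ← h2]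
    simp only [hval, zsmul_eq_mul]
    ring
  -- the parameters at which the line meets a hyperplane
  set C : Set ℝ := {s | ∃ γ, ∃ k : ℤ, val s γ = k} with hC
  have hcont : ∀ γ, Continuous fun s => val s γ := fun γ => by simp only [hval]; fun_prop
  have hfin : (C ∩ Set.Icc 0 1).Finite := by
    have : C ∩ Set.Icc 0 1 ⊆ ⋃ γ, (fun k : ℤ => (k - e (P.coroot γ)) / (P.coroot' γ x : ℝ)) ''
        Set.Icc ⌊e (P.coroot γ) - |(P.coroot' γ x : ℝ)|⌋
          ⌈e (P.coroot γ) + |(P.coroot' γ x : ℝ)|⌉ := by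
      rintro s ⟨⟨γ, k, h⟩, h0, h1⟩
      have hn : (P.coroot' γ x : ℝ) ≠ 0 := by exact_mod_cast hne _ _ _ h
      refine Set.mem_iUnion.2 ⟨γ, k, ?_, ?_⟩
      · have h2 : |s * (P.coroot' γ x : ℝ)| ≤ |(P.coroot' γ x : ℝ)| := by
          rw [abs_mul, abs_of_nonneg h0]
          exact mul_le_of_le_one_left (abs_nonneg _) h1
        obtain ⟨h3, h4⟩ := abs_le.1 h2
        simp only [hval] at h
        constructor
        · have : (⌊e (P.coroot γ) - |(P.coroot' γ x : ℝ)|⌋ : ℝ) ≤ k :=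
            (Int.floor_le _).trans (by linarith)
          exact_mod_cast this
        · have : (k : ℝ) ≤ ⌈e (P.coroot γ) + |(P.coroot' γ x : ℝ)|⌉ :=
            le_trans (by linarith) (Int.le_ceil _)
          exact_mod_cast this
      · simp only [hval] at h
        simp only
        rw [div_eq_iff hn]
        linarith
    exact (Set.finite_iUnion fun γ => (Set.finite_Icc _ _).image _).subset this
  have hfloor : ∀ (a b : ℝ) (γ : ι), a ≤ b → (∀ s ∈ Set.Icc a b, ∀ k : ℤ, val s γ ≠ k) →
      ∀ s ∈ Set.Icc a b, ∀ t ∈ Set.Icc a b, ⌊val s γ⌋ = ⌊val t γ⌋ := by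
    intro a b γ hab h s hs t ht
    exact floor_eq_of_isPreconnected isPreconnected_Icc (hcont γ).continuousOn h hs ht
  -- the crossing of a single critical parameter
  have hstep : ∀ a b c : ℝ, a < c → c < b → c ∈ C → (∀ s ∈ Set.Icc a b, s ∈ C → s = c) →
      ∃ j d, Step P (fun γ => ⌊val a γ⌋) (fun γ => ⌊val b γ⌋) j d := by
    intro a b c hac hcb hc honly
    obtain ⟨δ, d, hd, hpos⟩ : ∃ δ, ∃ d : ℤ, val c δ = d ∧ 0 < P.coroot' δ x := by
      obtain ⟨γ, k, h⟩ := hc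
      rcases lt_or_gt_of_ne (hne _ _ _ h) with h1 | h1
      · refine ⟨negIdx P γ, -k, ?_, by simpa using h1⟩
        simp only [hval] at h ⊢
        rw [coroot_negIdx, coroot'_negIdx, map_neg]
        push_cast
        linarith
      · exact ⟨γ, k, h, h1⟩
    have hposR : (0 : ℝ) < (P.coroot' δ x : ℝ) := by exact_mod_cast hpos
    have hacC : a ∉ C := fun h => hac.ne (honly a ⟨le_rfl, by linarith⟩ h)
    have hbcC : b ∉ C := fun h => hcb.ne' (honly b ⟨by linarith, le_rfl⟩ h)
    have hd' : e (P.coroot δ) = d - c * (P.coroot' δ x : ℝ) := by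
      simp only [hval] at hd; linarith
    -- the parameter at which the coroot of `δ` takes the value `k`
    have hk : ∀ k : ℤ, val (c + (k - d) / (P.coroot' δ x : ℝ)) δ = k := by
      intro k
      simp only [hval, hd']
      field_simp
      ring
    have ha1 : val a δ < d := by
      simp only [hval, hd']; nlinarith
    have hb1 : (d : ℝ) < val b δ := by
      simp only [hval, hd']; nlinarith
    have ha2 : (d : ℝ) - 1 < val a δ := by
      by_contra! h
      have h1 := hk (d - 1)
      have h2 := honly _ ⟨?_, ?_⟩ ⟨δ, _, h1⟩
      · push_cast at h2
        have : (d - 1 - d : ℝ) / (P.coroot' δ x : ℝ) < 0 :=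
          div_neg_of_neg_of_pos (by linarith) hposR
        linarith
      · push_cast
        simp only [hval, hd'] at h
        rw [← sub_le_iff_le_add', le_div_iff₀ hposR]
        linarith
      · push_cast
        have : (d - 1 - d : ℝ) / (P.coroot' δ x : ℝ) < 0 :=
          div_neg_of_neg_of_pos (by linarith) hposR
        linarith
    have hb2 : val b δ < d + 1 := by
      by_contra! h
      have h1 := hk (d + 1)
      have h2 := honly _ ⟨?_, ?_⟩ ⟨δ, _, h1⟩
      · push_cast at h2
        have : 0 < (d + 1 - d : ℝ) / (P.coroot' δ x : ℝ) := div_pos (by linarith) hposR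
        linarith
      · push_cast
        have : 0 < (d + 1 - d : ℝ) / (P.coroot' δ x : ℝ) := div_pos (by linarith) hposR
        linarith
      · push_cast
        simp only [hval, hd'] at h
        rw [← le_sub_iff_add_le', div_le_iff₀ hposR]
        linarith
    have hconst : ∀ γ, γ ≠ δ → γ ≠ negIdx P δ → ∀ s ∈ Set.Icc a b, ∀ t ∈ Set.Icc a b,
        ⌊val s γ⌋ = ⌊val t γ⌋ := by
      intro γ h1 h2
      refine hfloor a b γ (by linarith) fun s hs k h => ?_
      have := honly s hs ⟨γ, k, h⟩
      subst this
      rcases huniq _ _ _ _ _ h hd with h3 | h3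
      exacts [h1 h3, h2 h3]
    have haI : a ∈ Set.Icc a b := ⟨le_rfl, by linarith⟩
    have hbI : b ∈ Set.Icc a b := ⟨by linarith, le_rfl⟩
    have hcI : c ∈ Set.Icc a b := ⟨by linarith, by linarith⟩
    have hvneg : ∀ s, val s (negIdx P δ) = -val s δ := by
      intro s
      simp only [hval, coroot_negIdx, coroot'_negIdx, map_neg]
      push_cast
      ring
    refine ⟨negIdx P δ, d, Step.of_off P ?_ ?_ ?_ ?_ ?_ ?_⟩
    · intro γ h1 h2
      rw [negIdx_negIdx] at h2
      exact hconst γ h2 h1 b hbI a haI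
    · rw [negIdx_negIdx, Int.floor_eq_iff]
      push_cast
      constructor <;> linarith
    · rw [negIdx_negIdx, Int.floor_eq_iff]
      constructor <;> linarith
    · rw [Int.floor_eq_iff, hvneg]
      push_cast
      constructor <;> linarith
    · rw [Int.floor_eq_iff, hvneg]
      push_cast
      constructor <;> linarith
    · intro γ h1 h2
      obtain ⟨h3, h4⟩ := ofIdx_smul_ne P h1 h2
      rw [negIdx_negIdx] at h2 h4
      rw [hconst _ h4 h3 b hbI c hcI, hconst _ h2 h1 a haI c hcI, ← Int.floor_add_intCast]
      congr 1
      simp only [hval, coroot_ofIdx_smul, coroot'_ofIdx_smul_idx, coroot_negIdx, coroot'_negIdx,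
        root_negIdx, map_sub, map_zsmul, map_neg, zsmul_eq_mul, hd']
      push_cast
      ring
  -- bisection of the interval between two critical parameters
  have hpath : ∀ n : ℕ, ∀ a b : ℝ, 0 ≤ a → a < b → b ≤ 1 → a ∉ C → b ∉ C →
      (C ∩ Set.Ioo a b).ncard = n →
      ∃ L, StepPath P (fun γ => ⌊val a γ⌋) L (fun γ => ⌊val b γ⌋) := by
    intro n
    induction n using Nat.strong_induction_on with
    | _ n ih =>
      intro a b h0 hab h1 ha hb hn
      have hsub : ∀ s t, a ≤ s → t ≤ b → C ∩ Set.Ioo s t ⊆ C ∩ Set.Ioo a b := fun s t h2 h3 =>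
        Set.inter_subset_inter_right _ (Set.Ioo_subset_Ioo h2 h3)
      have hfin' : (C ∩ Set.Ioo a b).Finite := hfin.subset <| Set.inter_subset_inter_right _
        fun s hs => ⟨by linarith [hs.1], by linarith [hs.2]⟩
      by_cases h2 : ∃ c₁ ∈ C ∩ Set.Ioo a b, ∃ c₂ ∈ C ∩ Set.Ioo a b, c₁ < c₂
      · obtain ⟨c₁, hc₁, c₂, hc₂, hlt⟩ := h2
        obtain ⟨t, ht, ht1, ht2⟩ := (hfin.countable.dense_compl ℝ).exists_between hlt
        have ht3 : t ∉ C := fun h => ht ⟨h, by linarith [hc₁.2.1], by linarith [hc₂.2.2]⟩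
        have e1 : (C ∩ Set.Ioo a t).ncard < n := by
          rw [← hn]
          refine Set.ncard_lt_ncard ⟨hsub _ _ le_rfl (by linarith [hc₂.2.2]), fun h => ?_⟩ hfin'
          linarith [(h hc₂).2.2]
        have e2 : (C ∩ Set.Ioo t b).ncard < n := by
          rw [← hn]
          refine Set.ncard_lt_ncard ⟨hsub _ _ (by linarith [hc₁.2.1]) le_rfl, fun h => ?_⟩ hfin'
          linarith [(h hc₁).2.1]
        obtain ⟨L, hL⟩ := ih _ e1 a t h0 (by linarith [hc₁.2.1]) (by linarith [hc₂.2.2]) ha ht3 rfl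
        obtain ⟨L', hL'⟩ :=
          ih _ e2 t b (by linarith [hc₁.2.1]) (by linarith [hc₂.2.2]) h1 ht3 hb rfl
        exact ⟨_, hL.append hL'⟩
      · by_cases h3 : ∃ c, c ∈ C ∩ Set.Ioo a b
        · obtain ⟨c, hc⟩ := h3
          obtain ⟨j, d, hj⟩ := hstep a b c hc.2.1 hc.2.2 hc.1 fun s hs hsC => by
            have hs' : s ∈ C ∩ Set.Ioo a b := by
              refine ⟨hsC, lt_of_le_of_ne hs.1 ?_, lt_of_le_of_ne hs.2 ?_⟩
              · rintro rfl; exact ha hsC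
              · rintro rfl; exact hb hsC
            push Not at h2
            exact le_antisymm (h2 c hc s hs') (h2 s hs' c hc)
          exact ⟨_, .cons hj (.nil _)⟩
        · refine ⟨[], ?_⟩
          have : (fun γ => ⌊val a γ⌋) = (fun γ => ⌊val b γ⌋) := by
            funext γ
            refine hfloor a b γ hab.le (fun s hs k h => h3 ⟨s, ⟨γ, k, h⟩, ?_, ?_⟩) a
              ⟨le_rfl, hab.le⟩ b ⟨hab.le, le_rfl⟩
            · refine lt_of_le_of_ne hs.1 ?_
              rintro rfl; exact ha ⟨γ, k, h⟩
            · refine lt_of_le_of_ne hs.2 ?_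
              rintro rfl; exact hb ⟨γ, k, h⟩
          rw [this]
          exact .nil _
  have h0 : (0 : ℝ) ∉ C := by
    rintro ⟨γ, k, h⟩
    simp only [hval, zero_mul, add_zero] at h
    exact P.ne_zero' γ (he _ _ h)
  have h1 : (1 : ℝ) ∉ C := by
    rintro ⟨γ, k, h⟩
    simp only [hval, one_mul] at h
    refine P.ne_zero' γ (he _ (k - P.coroot' γ x) ?_)
    push_cast
    linarith
  obtain ⟨L, hL⟩ := hpath _ 0 1 le_rfl one_pos le_rfl h0 h1 rfl
  refine ⟨L, ?_⟩
  convert hL using 2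
  · simp [hval]
  · simp [hval]

end Path

section Generic

variable {ι X Y : Type*} [Finite ι] [AddCommGroup X] [AddCommGroup Y] {P : RootPairing ι ℤ X Y}
  [P.IsReduced] (b : P.Base)

/-- A generic point of the fundamental alcove: its values at the simple coroots are the powers of a
small transcendental number. -/
theorem exists_generic (hsc : Submodule.span ℤ (Set.range P.coroot) = ⊤) :
    ∃ e : Y →ₗ[ℤ] ℝ, (∀ (y : Y) (k : ℤ), e y = k → y = 0) ∧
      ∀ γ, ⌊e (P.coroot γ)⌋ = fundPos b γ := by
  classical
  have hspan : ⊤ ≤ Submodule.span ℤ (Set.range fun i : b.support => P.coroot i) := by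
    rw [← hsc, ← b.span_int_coroot_support]
    apply Submodule.span_mono
    rintro _ ⟨i, hi, rfl⟩
    exact ⟨⟨i, hi⟩, rfl⟩
  let cb : Module.Basis b.support ℤ Y := Module.Basis.mk b.linearIndepOn_coroot hspan
  let idx := Fintype.equivFin b.support
  obtain ⟨N, hN⟩ : ∃ N : ℤ, ∀ γ, b.flip.height γ ≤ N := by
    obtain ⟨N, hN⟩ := (Set.finite_range b.flip.height).bddAbove
    exact ⟨N, fun γ => hN ⟨γ, rfl⟩⟩
  -- `t` is small enough for all coroots, which have height at most `N`, to take values below `1`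
  obtain ⟨t, ht, ht0, ht1⟩ := ((Algebraic.countable ℤ ℝ).dense_compl ℝ).exists_between
    (show (0 : ℝ) < 1 / (|N| + 1) by positivity)
  have htt : Transcendental ℤ t := ht
  have hN0 : (0 : ℝ) ≤ (|N| : ℤ) := by exact_mod_cast abs_nonneg N
  have ht2 : t * (|N| + 1) < 1 := by rwa [lt_div_iff₀ (by positivity)] at ht1
  have ht3 : t < 1 := by nlinarith
  set e : Y →ₗ[ℤ] ℝ := cb.constr ℤ (fun i => t ^ ((idx i : ℕ) + 1)) with he
  have hei : ∀ i : b.support, e (P.coroot i) = t ^ ((idx i : ℕ) + 1) := by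
    intro i
    have : cb i = P.coroot i := by simp [cb]
    rw [← this, he, Module.Basis.constr_basis]
  have hgen : ∀ (y : Y) (k : ℤ), e y = k → y = 0 := by
    intro y k h
    -- an integral value would be an algebraic equation for `t`
    have h1 : (∑ i, Polynomial.C (cb.repr y i) * Polynomial.X ^ ((idx i : ℕ) + 1) -
        Polynomial.C k : Polynomial ℤ) = 0 := by
      refine transcendental_iff.1 htt _ ?_
      rw [map_sub, map_sum]
      simp only [map_mul, map_pow, Polynomial.aeval_X, eq_intCast, map_intCast]
      rw [sub_eq_zero, ← h, he, Module.Basis.constr_apply_fintype]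
      simp [zsmul_eq_mul]
    apply cb.repr.injective
    ext i
    have h2 := congrArg (fun p => Polynomial.coeff p ((idx i : ℕ) + 1)) h1
    simp only [Polynomial.coeff_sub, Polynomial.finsetSum_coeff, Polynomial.coeff_C_mul,
      Polynomial.coeff_X_pow, Polynomial.coeff_C_succ, Polynomial.coeff_zero, sub_zero,
      add_left_inj, mul_ite, mul_one, mul_zero, Fin.val_inj, idx.injective.eq_iff,
      Finset.sum_ite_eq, Finset.mem_univ, if_true] at h2
    simpa using h2
  have hpos : ∀ γ, b.IsPos γ → 0 < e (P.coroot γ) ∧ e (P.coroot γ) < 1 := by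
    intro γ hγ
    rw [isPos_iff_isPos_flip, RootPairing.Base.isPos_iff] at hγ
    obtain ⟨f, hf0, hf1, hf2⟩ := b.flip.exists_root_eq_sum_int γ
    have hh := b.flip.height_eq_sum hf2
    change P.coroot γ = ∑ j ∈ b.support, f j • P.coroot j at hf2
    change b.flip.height γ = ∑ j ∈ b.support, f j at hh
    have hf : ∀ j, 0 ≤ f j := by
      rcases hf1 with h | h
      · exact fun j => h.le j
      · have : ∑ j ∈ b.support, f j ≤ 0 := Finset.sum_nonpos fun j _ => h.le j
        omega
    have hsum : e (P.coroot γ) = ∑ j ∈ b.support, (f j : ℝ) * e (P.coroot j) := by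
      rw [hf2, map_sum]
      simp only [map_zsmul, zsmul_eq_mul]
    have hj : ∀ j ∈ b.support, 0 ≤ e (P.coroot j) ∧ e (P.coroot j) ≤ t := by
      intro j hj
      rw [hei ⟨j, hj⟩]
      exact ⟨by positivity, pow_le_of_le_one ht0.le ht3.le (by omega)⟩
    constructor
    · refine lt_of_le_of_ne ?_ fun h => P.ne_zero' γ (hgen _ 0 (by simpa using h.symm))
      rw [hsum]
      exact Finset.sum_nonneg fun j h => mul_nonneg (by exact_mod_cast hf j) (hj j h).1
    · have h1 : e (P.coroot γ) ≤ ∑ j ∈ b.support, (f j : ℝ) * t := by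
        rw [hsum]
        exact Finset.sum_le_sum fun j h =>
          mul_le_mul_of_nonneg_left (hj j h).2 (by exact_mod_cast hf j)
      rw [← Finset.sum_mul] at h1
      have h2 : (∑ j ∈ b.support, (f j : ℝ)) ≤ |N| + 1 := by
        have h3 : (∑ j ∈ b.support, (f j : ℝ)) = (b.flip.height γ : ℝ) := by
          rw [hh]; push_cast; rfl
        have h4 : (b.flip.height γ : ℝ) ≤ N := by exact_mod_cast hN γ
        rw [h3]
        push_cast
        linarith [le_abs_self (N : ℝ)]
      nlinarith
  refine ⟨e, hgen, fun γ => ?_⟩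
  by_cases hγ : b.IsPos γ
  · obtain ⟨h1, h2⟩ := hpos γ hγ
    rw [fundPos, if_pos hγ, Int.floor_eq_iff]
    push_cast
    constructor <;> linarith
  · obtain ⟨h1, h2⟩ := hpos (negIdx P γ) (by rwa [isPos_negIdx])
    rw [coroot_negIdx, map_neg] at h1 h2
    rw [fundPos, if_neg hγ, Int.floor_eq_iff]
    push_cast
    constructor <;> linarith

theorem exists_stepPath (hsc : Submodule.span ℤ (Set.range P.coroot) = ⊤) (x : X) :
    ∃ L, StepPath P (fundPos b) L (fun γ => fundPos b γ + P.coroot' γ x) := by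
  obtain ⟨e, h1, h2⟩ := exists_generic b hsc
  obtain ⟨L, hL⟩ := exists_stepPath_of_generic P h1 x
  simp only [h2] at hL
  exact ⟨L, hL⟩

end Generic

/-! ### From alcove paths to positions; reversal of a chain -/

section Geometry

variable {ι X Y : Type*} [AddCommGroup X] [AddCommGroup Y] {P : RootPairing ι ℤ X Y}

theorem RealWeights.add_apply (x y : RealWeights Y) (a : Y) : (x + y) a = x a + y a := rfl

theorem RealWeights.sub_apply (x y : RealWeights Y) (a : Y) : (x - y) a = x a - y a := rfl

theorem RealWeights.smul_apply (c : ℝ) (x : RealWeights Y) (a : Y) : (c • x) a = c * x a := rfl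

theorem RealWeights.map_sub (x : RealWeights Y) (a c : Y) : x (a - c) = x a - x c :=
  LinearMap.map_sub (show Y →ₗ[ℤ] ℝ from x) a c

theorem RealWeights.map_neg (x : RealWeights Y) (a : Y) : x (-a) = -x a :=
  LinearMap.map_neg (show Y →ₗ[ℤ] ℝ from x) a

theorem RealWeights.map_zsmul (x : RealWeights Y) (n : ℤ) (a : Y) : x (n • a) = n * x a := by
  have := LinearMap.map_smul (show Y →ₗ[ℤ] ℝ from x) n a
  rwa [zsmul_eq_mul] at this

theorem toReal_coroot (lam : X) (i : ι) : toReal P lam (P.coroot i) = (P.coroot' i lam : ℝ) := rfl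

theorem continuous_eval (a : Y) : Continuous fun x : RealWeights Y => x a :=
  (continuous_apply a).comp continuous_induced_dom

/-- The integral parts of the coroots at the points of `A`. -/
structure HasPosition (P : RootPairing ι ℤ X Y) (A : Set (RealWeights Y)) (p : ι → ℤ) : Prop where
  nonempty : A.Nonempty
  floor : ∀ x ∈ A, ∀ γ, ⌊x (P.coroot γ)⌋ = p γ
  regular : A ⊆ regularSet P

theorem IsAlcove.exists_hasPosition {A : Set (RealWeights Y)} (hA : IsAlcove P A) :
    ∃ p, HasPosition P A p := by
  obtain ⟨x, hx, rfl⟩ := hA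
  have hsub := connectedComponentIn_subset (regularSet P) x
  refine ⟨fun γ => ⌊x (P.coroot γ)⌋, ⟨x, mem_connectedComponentIn hx⟩, fun y hy γ => ?_, hsub⟩
  exact floor_eq_of_isPreconnected isPreconnected_connectedComponentIn
    (continuous_eval (P.coroot γ)).continuousOn (fun z hz k => hsub hz γ k) hy
    (mem_connectedComponentIn hx)

theorem HasPosition.negIdx {A : Set (RealWeights Y)} {p : ι → ℤ} (h : HasPosition P A p) (γ : ι) :
    p (negIdx P γ) = -p γ - 1 := by
  obtain ⟨x, hx⟩ := h.nonempty
  rw [← h.floor x hx, Int.floor_eq_iff, coroot_negIdx, RealWeights.map_neg]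
  have h1 := h.floor x hx γ
  rw [Int.floor_eq_iff] at h1
  have h2 : x (P.coroot γ) ≠ p γ := h.regular hx γ (p γ)
  have h3 := lt_of_le_of_ne h1.1 h2.symm
  push_cast
  constructor <;> linarith [h1.2]

theorem HasPosition.closure {A : Set (RealWeights Y)} {p : ι → ℤ} (h : HasPosition P A p)
    {z : RealWeights Y} (hz : z ∈ closure A) (γ : ι) :
    p γ ≤ z (P.coroot γ) ∧ z (P.coroot γ) ≤ p γ + 1 := by
  have hc := continuous_eval (P.coroot γ)
  have hcl : IsClosed {z : RealWeights Y | p γ ≤ z (P.coroot γ) ∧ z (P.coroot γ) ≤ p γ + 1} :=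
    (isClosed_le continuous_const hc).inter (isClosed_le hc continuous_const)
  refine closure_minimal (fun x hx => ?_) hcl hz
  have h1 := h.floor x hx γ
  rw [Int.floor_eq_iff] at h1
  exact ⟨h1.1, h1.2.le⟩

variable [Finite ι] [P.IsReduced]

/-- Hyperplanes of different roots, up to sign, are not parallel. -/
theorem eq_or_eq_negIdx_of_hyperplane_subset {i γ : ι} {k m : ℤ}
    (h : hyperplane P i k ⊆ hyperplane P γ m) : γ = i ∨ γ = negIdx P i := by
  refine eq_or_eq_negIdx_of_smul_coroot P (m := 2) two_ne_zero
    (n := P.coroot' γ (P.root i)) ?_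
  -- a point of the first hyperplane, which is then moved by the multiples of `f` along it
  set z : RealWeights Y := ((k : ℝ) / 2) • toReal P (P.root i) with hz
  have hz1 : z ∈ hyperplane P i k := by
    change z (P.coroot i) = k
    rw [hz, RealWeights.smul_apply, toReal_coroot, coroot'_root_self]
    push_cast
    ring
  have key : ∀ x : X, 2 * P.coroot' γ x = P.coroot' γ (P.root i) * P.coroot' i x := by
    intro x
    set f : RealWeights Y := toReal P ((2 : ℤ) • x - P.coroot' i x • P.root i) with hf
    have h1 : z + f ∈ hyperplane P i k := by
      change (z + f) (P.coroot i) = k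
      have h2 : z (P.coroot i) = k := hz1
      rw [RealWeights.add_apply, h2, hf, toReal_coroot, _root_.map_sub, map_smul, map_smul,
        coroot'_root_self]
      simp only [smul_eq_mul]
      push_cast
      ring
    have h3 : (z + f) (P.coroot γ) = m := h h1
    have h4 : z (P.coroot γ) = m := h hz1
    rw [RealWeights.add_apply, h4, hf, toReal_coroot, _root_.map_sub, map_smul, map_smul] at h3
    simp only [smul_eq_mul] at h3
    have h5 : ((2 * P.coroot' γ x - P.coroot' i x * P.coroot' γ (P.root i) : ℤ) : ℝ) = 0 := by
      linarith
    have h6 := Int.cast_eq_zero.1 h5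
    linarith
  apply (LinearMap.IsPerfPair.bijective_right P.toLinearMap).injective
  ext x
  rw [map_smul, map_smul]
  exact key x

omit [Finite ι] [P.IsReduced] in
theorem affineSpan_subset_hyperplane {s : Set (RealWeights Y)} {γ : ι} {m : ℤ}
    (h : s ⊆ hyperplane P γ m) : (affineSpan ℝ s : Set (RealWeights Y)) ⊆ hyperplane P γ m := by
  let Q : AffineSubspace ℝ (RealWeights Y) :=
    { carrier := hyperplane P γ m
      smul_vsub_vadd_mem' := by
        intro c x y z hx hy hz
        change (c • (x - y) + z) (P.coroot γ) = m
        have hx' : x (P.coroot γ) = m := hx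
        have hy' : y (P.coroot γ) = m := hy
        have hz' : z (P.coroot γ) = m := hz
        rw [RealWeights.add_apply, RealWeights.smul_apply, RealWeights.sub_apply, hx', hy', hz']
        ring }
  exact affineSpan_le.2 (show s ⊆ (Q : Set (RealWeights Y)) from h)

/-- Two alcoves separated by a common wall are the reflections of each other in this wall, and no
other hyperplane separates them. -/
theorem Crosses.step {A A' : Set (RealWeights Y)} {p p' : ι → ℤ} (hA : HasPosition P A p)
    (hA' : HasPosition P A' p') {j : ι} {d : ℤ} (h : Crosses P A A' (negIdx P j) d) :
    Step P p p' j d := by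
  -- the common wall lies on no hyperplane of another root
  have hwall : ∀ (γ : ι) (m : ℤ), γ ≠ j → γ ≠ negIdx P j →
      ¬ (∀ z ∈ closure A ∩ closure A', z (P.coroot γ) = m) := by
    intro γ m h1 h2 h3
    have h4 := affineSpan_subset_hyperplane (P := P) (γ := γ) (m := m) h3
    rw [h.wall] at h4
    rcases eq_or_eq_negIdx_of_hyperplane_subset h4 with h5 | h5
    · exact h2 h5
    · rw [negIdx_negIdx] at h5
      exact h1 h5
  have hon : ∀ z ∈ closure A ∩ closure A', z (P.coroot (negIdx P j)) = d := by
    intro z hz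
    have : z ∈ (affineSpan ℝ (closure A ∩ closure A') : Set (RealWeights Y)) :=
      subset_affineSpan ℝ _ hz
    rw [h.wall] at this
    exact this
  obtain ⟨z, hz⟩ : (closure A ∩ closure A').Nonempty := by
    rw [← affineSpan_nonempty ℝ, h.wall]
    refine ⟨((d : ℝ) / 2) • toReal P (P.root (negIdx P j)), ?_⟩
    change _ = _
    rw [RealWeights.smul_apply, toReal_coroot, coroot'_root_self]
    push_cast
    ring
  have hzd := hon z hz
  have hz1 := hA.closure hz.1 (negIdx P j)
  have hz2 := hA'.closure hz.2 (negIdx P j)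
  obtain ⟨x, hx⟩ := hA.nonempty
  obtain ⟨x', hx'⟩ := hA'.nonempty
  have e1 : p (negIdx P j) = d - 1 := by
    have h1 := hA.floor x hx (negIdx P j)
    have h2 := h.left x hx
    rw [Int.floor_eq_iff] at h1
    have h3 : p (negIdx P j) < d := by exact_mod_cast h1.1.trans_lt h2
    have h4 : d ≤ p (negIdx P j) + 1 := by rw [hzd] at hz1; exact_mod_cast hz1.2
    omega
  have e2 : p' (negIdx P j) = d := by
    have h1 := hA'.floor x' hx' (negIdx P j)
    have h2 := h.right x' hx'
    rw [Int.floor_eq_iff] at h1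
    have h3 : d < p' (negIdx P j) + 1 := by exact_mod_cast h2.trans h1.2
    have h4 : p' (negIdx P j) ≤ d := by rw [hzd] at hz2; exact_mod_cast hz2.1
    omega
  -- a difference of positions would put the common wall on a hyperplane of `γ`
  have hoff : ∀ γ, γ ≠ j → γ ≠ negIdx P j → p' γ = p γ := by
    intro γ h1 h2
    rcases lt_trichotomy (p' γ) (p γ) with h3 | h3 | h3
    · refine absurd (fun z hz => ?_) (hwall γ (p γ) h1 h2)
      have h4 : (p' γ : ℝ) + 1 ≤ p γ := by exact_mod_cast h3
      linarith [(hA.closure hz.1 γ).1, (hA'.closure hz.2 γ).2]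
    · exact h3
    · refine absurd (fun z hz => ?_) (hwall γ (p' γ) h1 h2)
      have h4 : (p γ : ℝ) + 1 ≤ p' γ := by exact_mod_cast h3
      linarith [(hA'.closure hz.2 γ).1, (hA.closure hz.1 γ).2]
  refine Step.of_off P hoff e1 e2 ?_ ?_ fun γ h1 h2 => ?_
  · rw [← negIdx_negIdx P j, hA.negIdx, e1]; ring
  · rw [← negIdx_negIdx P j, hA'.negIdx, e2]
  · obtain ⟨h3, h4⟩ := ofIdx_smul_ne P h1 h2
    rw [hoff _ h3 h4]
    -- on the common wall the coroots `s_β γ^∨` and `γ^∨` differ by the integer in question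
    have hval : ∀ z ∈ closure A ∩ closure A', z (P.coroot (ofIdx P j • γ)) =
        z (P.coroot γ) + ((d * P.coroot' γ (P.root j) : ℤ) : ℝ) := by
      intro z hz
      have h5 := hon z hz
      rw [coroot_negIdx, RealWeights.map_neg] at h5
      rw [coroot_ofIdx_smul, RealWeights.map_sub, RealWeights.map_zsmul,
        show z (P.coroot j) = -d by linarith]
      push_cast
      ring
    rcases lt_trichotomy (p (ofIdx P j • γ)) (p γ + d * P.coroot' γ (P.root j)) with h5 | h5 | h5
    · refine absurd (fun z hz => ?_) (hwall γ (p γ) h1 h2)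
      have h6 : (p (ofIdx P j • γ) : ℝ) + 1 ≤ p γ + ((d * P.coroot' γ (P.root j) : ℤ) : ℝ) := by
        exact_mod_cast h5
      have h7 := hA.closure hz.1 (ofIdx P j • γ)
      rw [hval z hz] at h7
      linarith [(hA.closure hz.1 γ).1]
    · exact h5
    · refine absurd (fun z hz => ?_) (hwall γ (p γ + 1) h1 h2)
      have h6 : (p γ : ℝ) + ((d * P.coroot' γ (P.root j) : ℤ) : ℝ) + 1 ≤ p (ofIdx P j • γ) := by
        exact_mod_cast h5
      have h7 := hA.closure hz.1 (ofIdx P j • γ)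
      rw [hval z hz] at h7
      push_cast
      linarith [(hA.closure hz.1 γ).2]

omit [Finite ι] [P.IsReduced] in
theorem floor_fundAlcove (b : P.Base) {x : RealWeights Y} (hx : x ∈ fundAlcove b) (γ : ι) :
    ⌊x (P.coroot γ)⌋ = fundPos b γ := by
  by_cases hγ : b.IsPos γ
  · obtain ⟨h1, h2⟩ := hx γ hγ
    rw [fundPos, if_pos hγ, Int.floor_eq_iff]
    push_cast
    constructor <;> linarith
  · obtain ⟨h1, h2⟩ := hx (negIdx P γ) (by rwa [isPos_negIdx])
    rw [coroot_negIdx, RealWeights.map_neg] at h1 h2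
    rw [fundPos, if_neg hγ, Int.floor_eq_iff]
    push_cast
    constructor <;> linarith

/-- The positions of the alcoves along a chain of roots. -/
theorem IsReducedChain.exists_positions {b : P.Base} {lam : X} {l : ℕ} {β : Fin l → ι}
    {d : Fin l → ℤ} (h : IsReducedChain b lam β d) : ∃ p : Fin (l + 1) → ι → ℤ,
      (∀ j : Fin l, Step P (p j.castSucc) (p j.succ) (β j) (d j)) ∧ p 0 = fundPos b ∧
      p (Fin.last l) = fun γ => fundPos b γ - P.coroot' γ lam := by
  obtain ⟨⟨A, hA, h0, h1⟩, -⟩ := h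
  choose p hp using fun j => (hA.alcove j).exists_hasPosition
  refine ⟨p, fun j => (hA.step j).step (hp _) (hp _), ?_, ?_⟩
  · funext γ
    obtain ⟨x, hx⟩ := (hp 0).nonempty
    rw [← (hp 0).floor x hx, floor_fundAlcove b (h0 ▸ hx)]
  · funext γ
    obtain ⟨x, hx⟩ := (hp (Fin.last l)).nonempty
    rw [← (hp _).floor x hx]
    rw [h1] at hx
    obtain ⟨y, hy, rfl⟩ := hx
    simp only
    rw [RealWeights.sub_apply, toReal_coroot, Int.floor_sub_intCast, floor_fundAlcove b hy]

end Geometry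

section Reversal

variable {ι X Y : Type*} [AddCommGroup X] [AddCommGroup Y] {P : RootPairing ι ℤ X Y}

/-- A crossing in the opposite direction. -/
theorem Step.reverse {p p' : ι → ℤ} {j : ι} {d : ℤ} (h : Step P p p' j d) :
    Step P p' p (negIdx P j) (-d) := by
  refine ⟨fun γ h1 h2 => ?_, ?_, ?_, ?_, ?_, fun γ => ?_⟩
  · rw [negIdx_negIdx] at h2
    exact (h.off γ h2 h1).symm
  · rw [negIdx_negIdx, h.right_self]
  · rw [negIdx_negIdx, h.left_self]
  · rw [h.right_neg, neg_neg]
  · rw [h.left_neg, neg_neg]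
  · have h1 := h.refl (ofIdx P j • γ)
    rw [← mul_smul, ofIdx_mul_self, one_smul, coroot'_ofIdx_smul_idx, coroot'_root_self] at h1
    rw [ofIdx_negIdx, root_negIdx, map_neg, h1]
    ring

theorem Step.translate {p p' : ι → ℤ} {j : ι} {d : ℤ} (h : Step P p p' j d) (x : X) :
    Step P (fun γ => p γ + P.coroot' γ x) (fun γ => p' γ + P.coroot' γ x) j
      (d - P.coroot' j x) := by
  refine ⟨fun γ h1 h2 => ?_, ?_, ?_, ?_, ?_, fun γ => ?_⟩
  · rw [h.off γ h1 h2]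
  · rw [h.left_neg, coroot'_negIdx]; ring
  · rw [h.right_neg, coroot'_negIdx]; ring
  · rw [h.left_self]; ring
  · rw [h.right_self]; ring
  · rw [h.refl, coroot'_ofIdx_smul_idx]
    ring

theorem stepPath_ofFn {l : ℕ} {β : Fin l → ι} {d : Fin l → ℤ} {p : Fin (l + 1) → ι → ℤ}
    (h : ∀ j : Fin l, Step P (p j.castSucc) (p j.succ) (β j) (d j)) :
    StepPath P (p 0) (List.ofFn fun j => (β j, d j)) (p (Fin.last l)) := by
  induction l with
  | zero => exact .nil _
  | succ l ih =>
    rw [List.ofFn_succ]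
    exact .cons (h 0) (ih (β := fun j => β j.succ) (d := fun j => d j.succ)
      (p := fun j => p j.succ) fun j => h j.succ)

variable [Finite ι] [P.IsReduced]

theorem IsReducedChain.stepPath {b : P.Base} {lam : X} {l : ℕ} {β : Fin l → ι} {d : Fin l → ℤ}
    (h : IsReducedChain b lam β d) : StepPath P (fundPos b) (List.ofFn fun j => (β j, d j))
      (fun γ => fundPos b γ + P.coroot' γ (-lam)) := by
  obtain ⟨p, h1, h2, h3⟩ := h.exists_positions
  have := stepPath_ofFn h1
  rw [h2, h3] at this
  simpa only [map_neg, ← sub_eq_add_neg] using this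

/-- The chain traversed backwards and translated by `λ` leads from the fundamental alcove to its
translate by `λ`. -/
theorem IsReducedChain.stepPath_rev {b : P.Base} {lam : X} {l : ℕ} {β : Fin l → ι} {d : Fin l → ℤ}
    (h : IsReducedChain b lam β d) : StepPath P (fundPos b)
      (List.ofFn fun j : Fin l => (negIdx P (β j.rev), P.coroot' (β j.rev) lam - d j.rev))
      (fun γ => fundPos b γ + P.coroot' γ lam) := by
  obtain ⟨p, h1, h2, h3⟩ := h.exists_positions
  have h4 := stepPath_ofFn (P := P) (l := l) (β := fun j => negIdx P (β j.rev))
    (d := fun j => P.coroot' (β j.rev) lam - d j.rev)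
    (p := fun j γ => p j.rev γ + P.coroot' γ lam) fun j => by
      have h5 := (h1 j.rev).reverse.translate lam
      rw [coroot'_negIdx, sub_neg_eq_add, neg_add_eq_sub] at h5
      rw [Fin.rev_castSucc, Fin.rev_succ]
      exact h5
  simpa [h2, h3] using h4

end Reversal

/-! ### The affine Hecke algebra: inverses, spanning set, anti-involution -/

section HeckeAlgebra

variable {ι X Y : Type*} [AddCommGroup X] [AddCommGroup Y] {P : RootPairing ι ℤ X Y} (b : P.Base)

/-- The affine Hecke algebra, as a type with a ring structure of its own: the operations of
`AffineHecke b` come from the semiring and from the ring structure of the free algebra, and these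
agree only after unfolding. -/
def HeckeRing (b : P.Base) : Type _ := AffineHecke b

instance : Ring (HeckeRing b) := inferInstanceAs (Ring (AffineHecke b))

instance : Algebra R (HeckeRing b) := inferInstanceAs (Algebra R (AffineHecke b))

/-- The quotient map onto the affine Hecke algebra. -/
def toHecke : FreeAlgebra R (Gen P) →ₐ[R] HeckeRing b := RingQuot.mkAlgHom R (Rel b)

theorem toHecke_surjective : Function.Surjective (toHecke b) :=
  RingQuot.mkAlgHom_surjective R (Rel b)

theorem toHecke_rel {x y : FreeAlgebra R (Gen P)} (h : Rel b x y) : toHecke b x = toHecke b y :=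
  RingQuot.mkAlgHom_rel R h

/-- An algebra homomorphism out of the affine Hecke algebra. -/
def liftHecke {A : Type*} [Ring A] [Algebra R A] (f : FreeAlgebra R (Gen P) →ₐ[R] A)
    (hf : ∀ ⦃x y⦄, Rel b x y → f x = f y) : HeckeRing b →ₐ[R] A :=
  RingQuot.liftAlgHom R (s := Rel b) ⟨f, hf⟩

theorem liftHecke_toHecke {A : Type*} [Ring A] [Algebra R A] (f : FreeAlgebra R (Gen P) →ₐ[R] A)
    (hf : ∀ ⦃x y⦄, Rel b x y → f x = f y) (x : FreeAlgebra R (Gen P)) :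
    liftHecke b f hf (toHecke b x) = f x :=
  RingQuot.liftAlgHom_mkAlgHom_apply R f hf x

/-- The element `T_w`. -/
def elT (w : P.weylGroup) : HeckeRing b := toHecke b (genT w)

/-- The element `X^λ`. -/
def elX (lam : X) : HeckeRing b := toHecke b (genX lam)

/-- The element `T_{w⁻¹}⁻¹`. -/
def elTinv (w : P.weylGroup) : HeckeRing b := Ring.inverse (elT b w⁻¹)

theorem elT_one : elT b 1 = 1 :=
  (toHecke_rel b Rel.T_one).trans (map_one _)

theorem elX_zero : elX b 0 = 1 :=
  (toHecke_rel b Rel.X_zero).trans (map_one _)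

theorem elX_add (lam mu : X) : elX b (lam + mu) = elX b lam * elX b mu :=
  (toHecke_rel b (Rel.X_add lam mu)).symm.trans (map_mul _ _ _)

theorem elT_mul {w y : P.weylGroup} (h : len b (w * y) = len b w + len b y) :
    elT b (w * y) = elT b w * elT b y :=
  (toHecke_rel b (Rel.T_mul w y h)).symm.trans (map_mul _ _ _)

theorem elT_quadratic {i : ι} (hi : i ∈ b.support) :
    (elT b (ofIdx P i) + 1) * (elT b (ofIdx P i) - algebraMap R _ q) = 0 := by
  have h := toHecke_rel b (Rel.quadratic i hi)
  simp only [map_mul, map_add, map_sub, map_one, map_zero, AlgHom.commutes] at h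
  exact h

theorem map_divDiff {A A' F : Type*} [AddCommGroup A] [AddCommGroup A'] [FunLike F A A']
    [AddMonoidHomClass F A A'] (φ : F) (x : X → A) (i : ι) (lam : X) :
    φ (divDiff P x i lam) = divDiff P (fun mu => φ (x mu)) i lam := by
  rw [divDiff_eq_stringSum, divDiff_eq_stringSum, map_sub, map_add, map_stringSum]

theorem elT_bernstein {i : ι} (hi : i ∈ b.support) (lam : X) :
    elT b (ofIdx P i) * elX b lam = elX b (ofIdx P i • lam) * elT b (ofIdx P i) +
      (1 - q) • divDiff P (elX b) i lam := by
  have h := toHecke_rel b (Rel.bernstein i hi lam)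
  rw [map_sub, map_mul, map_mul, map_smul, map_divDiff] at h
  rw [← sub_eq_iff_eq_add']
  exact h

theorem isUnit_q : IsUnit q := LaurentPolynomial.isUnit_T 1

theorem elT_simple_sq {i : ι} (hi : i ∈ b.support) :
    elT b (ofIdx P i) * elT b (ofIdx P i) =
      (q - 1) • elT b (ofIdx P i) + q • (1 : HeckeRing b) := by
  have h := elT_quadratic b hi
  rw [Algebra.algebraMap_eq_smul_one] at h
  rw [add_mul, mul_sub, mul_smul_comm, mul_one, one_mul] at h
  rw [sub_smul, one_smul]
  rw [← sub_eq_zero]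
  rw [← h]
  abel

variable [Finite ι] [P.IsReduced]

theorem len_simple {i : ι} (hi : i ∈ b.support) : len b (ofIdx P i) = 1 := by
  have := len_simple_mul_of_pos b hi (w := 1) (by simpa using b.isPos_of_mem_support hi)
  simpa using this

omit [Finite ι] [P.IsReduced] in
theorem isUnit_elT_simple {i : ι} (hi : i ∈ b.support) : IsUnit (elT b (ofIdx P i)) := by
  obtain ⟨u, hu⟩ := isUnit_q
  have h := elT_simple_sq b hi
  rw [← hu] at h
  have e : elT b (ofIdx P i) * elT b (ofIdx P i) -
      ((u : R) - 1) • elT b (ofIdx P i) = (u : R) • (1 : HeckeRing b) := by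
    rw [h]; abel
  refine ⟨⟨elT b (ofIdx P i), (↑u⁻¹ : R) • (elT b (ofIdx P i) - ((u : R) - 1) • 1), ?_, ?_⟩,
    rfl⟩
  · rw [mul_smul_comm, mul_sub, mul_smul_comm, mul_one, e, smul_smul, Units.inv_mul, one_smul]
  · rw [smul_mul_assoc, sub_mul, smul_mul_assoc, one_mul, e, smul_smul, Units.inv_mul, one_smul]

/-- Induction on the length: a property of `1` that passes from `w` to `s w > w`. -/
theorem weyl_length_induction {p : P.weylGroup → Prop} (one : p 1)
    (step : ∀ i ∈ b.support, ∀ w : P.weylGroup, b.IsPos (w⁻¹ • i) → p w → p (ofIdx P i * w))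
    (w : P.weylGroup) : p w := by
  induction hn : len b w using Nat.strong_induction_on generalizing w with
  | _ n ih =>
    by_cases hw : w = 1
    · rwa [hw]
    obtain ⟨i, hi, hlt⟩ := exists_mul_simple_len_lt b (inv_ne_one.2 hw)
    rw [len_inv, ← len_inv, mul_inv_rev, inv_inv, ofIdx_inv] at hlt
    have h1 : b.IsPos ((ofIdx P i * w)⁻¹ • i) := by
      by_contra h
      have := len_simple_mul_of_neg b hi h
      rw [← mul_assoc, ofIdx_mul_self, one_mul] at this
      omega
    have h2 := step i hi _ h1 (ih _ (hn ▸ hlt) _ rfl)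
    rwa [← mul_assoc, ofIdx_mul_self, one_mul] at h2

theorem elT_simple_mul {i : ι} (hi : i ∈ b.support) {w : P.weylGroup}
    (h : b.IsPos (w⁻¹ • i)) :
    elT b (ofIdx P i * w) = elT b (ofIdx P i) * elT b w :=
  elT_mul b (by rw [len_simple_mul_of_pos b hi h, len_simple b hi, add_comm])

theorem isUnit_elT (w : P.weylGroup) : IsUnit (elT b w) := by
  induction w using weyl_length_induction b with
  | one => rw [elT_one]; exact isUnit_one
  | step i hi w hw ih =>
    rw [elT_simple_mul b hi hw]
    exact (isUnit_elT_simple b hi).mul ih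

theorem elT_mul_elTinv (w : P.weylGroup) : elT b w⁻¹ * elTinv b w = 1 :=
  Ring.mul_inverse_cancel _ (isUnit_elT b _)

theorem elTinv_mul_elT (w : P.weylGroup) : elTinv b w * elT b w⁻¹ = 1 :=
  Ring.inverse_mul_cancel _ (isUnit_elT b _)

theorem elTinv_one : elTinv b 1 = 1 := by
  simpa [elT_one] using elT_mul_elTinv b 1

theorem elT_mul_elTinv_simple_mul {i : ι} (hi : i ∈ b.support) {w : P.weylGroup}
    (h : b.IsPos (w⁻¹ • i)) :
    elT b (ofIdx P i) * elTinv b (ofIdx P i * w) = elTinv b w := by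
  have h1 : elT b (ofIdx P i * w)⁻¹ = elT b w⁻¹ * elT b (ofIdx P i) := by
    rw [mul_inv_rev, ofIdx_inv]
    refine elT_mul b ?_
    rw [← len_inv, mul_inv_rev, inv_inv, ofIdx_inv, len_simple_mul_of_pos b hi h, len_simple b hi,
      len_inv]
  apply (isUnit_elT b w⁻¹).mul_left_cancel
  rw [← mul_assoc, ← h1, elT_mul_elTinv, elT_mul_elTinv]

theorem elT_mul_elTinv_of_pos {i : ι} (hi : i ∈ b.support) {w : P.weylGroup}
    (h : b.IsPos (w⁻¹ • i)) : elT b (ofIdx P i) * elTinv b w =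
      q • elTinv b (ofIdx P i * w) + (q - 1) • elTinv b w := by
  rw [← elT_mul_elTinv_simple_mul b hi h, ← mul_assoc, elT_simple_sq b hi, add_mul,
    smul_mul_assoc, smul_mul_assoc, one_mul, add_comm]

omit [Finite ι] [P.IsReduced] in
theorem hecke_induction {p : HeckeRing b → Prop} (hR : ∀ r : R, p (algebraMap R _ r))
    (hT : ∀ w, p (elT b w)) (hX : ∀ lam, p (elX b lam)) (hmul : ∀ x y, p x → p y → p (x * y))
    (hadd : ∀ x y, p x → p y → p (x + y)) (a : HeckeRing b) : p a := by
  obtain ⟨a, rfl⟩ := toHecke_surjective b a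
  induction a using FreeAlgebra.induction with
  | grade0 r => rw [AlgHom.commutes]; exact hR r
  | grade1 x =>
    rcases x with w | lam
    exacts [hT w, hX lam]
  | mul x y hx hy => rw [map_mul]; exact hmul _ _ hx hy
  | add x y hx hy => rw [map_add]; exact hadd _ _ hx hy

omit [Finite ι] [P.IsReduced] in
theorem divDiff_mem {A : Type*} [AddCommGroup A] [Module R A] {N : Submodule R A} {x : X → A}
    (h : ∀ lam, x lam ∈ N) (i : ι) (lam : X) : divDiff P x i lam ∈ N := by
  unfold divDiff
  split_ifs
  · exact N.neg_mem (N.sum_mem fun k _ => h _)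
  · exact N.sum_mem fun k _ => h _

/-- The elements `X^μ T_{u⁻¹}⁻¹` span the affine Hecke algebra: their span is a left ideal. -/
theorem span_elX_mul_elTinv :
    Submodule.span R (Set.range fun g : P.weylGroup × X => elX b g.2 * elTinv b g.1) = ⊤ := by
  set N := Submodule.span R (Set.range fun g : P.weylGroup × X => elX b g.2 * elTinv b g.1)
    with hN
  have hmem : ∀ u mu, elX b mu * elTinv b u ∈ N := fun u mu =>
    Submodule.subset_span ⟨(u, mu), rfl⟩
  have hideal : ∀ a : HeckeRing b, (∀ u mu, a * (elX b mu * elTinv b u) ∈ N) →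
      ∀ n ∈ N, a * n ∈ N := by
    intro a ha n hn
    induction hn using Submodule.span_induction with
    | mem x hx => obtain ⟨g, rfl⟩ := hx; exact ha _ _
    | zero => rw [mul_zero]; exact N.zero_mem
    | add x y _ _ hx hy => rw [mul_add]; exact N.add_mem hx hy
    | smul r x _ hx => rw [mul_smul_comm]; exact N.smul_mem _ hx
  have hsimple : ∀ i ∈ b.support, ∀ n ∈ N, elT b (ofIdx P i) * n ∈ N := by
    intro i hi
    refine hideal _ fun u mu => ?_
    rw [← mul_assoc, elT_bernstein b hi, add_mul, mul_assoc, smul_mul_assoc]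
    refine N.add_mem ?_ (N.smul_mem _ ?_)
    · by_cases h : b.IsPos (u⁻¹ • i)
      · rw [elT_mul_elTinv_of_pos b hi h, mul_add, mul_smul_comm, mul_smul_comm]
        exact N.add_mem (N.smul_mem _ (hmem _ _)) (N.smul_mem _ (hmem _ _))
      · have h1 : b.IsPos ((ofIdx P i * u)⁻¹ • i) := by
          rwa [mul_inv_rev, mul_smul, ofIdx_inv, ofIdx_smul_self, weyl_smul_negIdx, isPos_negIdx]
        have h2 := elT_mul_elTinv_simple_mul b hi h1
        rw [← mul_assoc, ofIdx_mul_self, one_mul] at h2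
        rw [h2]
        exact hmem _ _
    · have h1 := map_divDiff (P := P) (AddMonoidHom.mulRight (elTinv b u)) (elX b) i mu
      simp only [AddMonoidHom.coe_mulRight] at h1
      rw [h1]
      exact divDiff_mem (N := N) (x := fun lam => elX b lam * elTinv b u) (fun lam => hmem _ _) i mu
  have hall : ∀ a : HeckeRing b, ∀ n ∈ N, a * n ∈ N := by
    intro a
    induction a using hecke_induction b with
    | hR r =>
      intro n hn
      rw [← Algebra.smul_def]
      exact N.smul_mem _ hn
    | hT w =>
      induction w using weyl_length_induction b with
      | one => intro n hn; rwa [elT_one, one_mul]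
      | step i hi w hw ih =>
        intro n hn
        rw [elT_simple_mul b hi hw, mul_assoc]
        exact hsimple i hi _ (ih n hn)
    | hX lam =>
      refine hideal _ fun u mu => ?_
      rw [← mul_assoc, ← elX_add]
      exact hmem _ _
    | hmul x y hx hy => intro n hn; rw [mul_assoc]; exact hx _ (hy _ hn)
    | hadd x y hx hy => intro n hn; rw [add_mul]; exact N.add_mem (hx _ hn) (hy _ hn)
  have h1 : (1 : HeckeRing b) ∈ N := by
    have := hmem 1 0
    rwa [elX_zero, elTinv_one, one_mul] at this
  rw [eq_top_iff]
  rintro a -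
  simpa using hall a 1 h1

omit [Finite ι] [P.IsReduced] in
theorem divDiff_reflect {A : Type*} [AddCommGroup A] (x : X → A) (i : ι) (lam : X) :
    divDiff P x i (ofIdx P i • lam) = -divDiff P x i lam := by
  have hn : P.coroot' i (ofIdx P i • lam) = -P.coroot' i lam := by
    rw [coroot'_weyl_smul_right, ofIdx_inv, ofIdx_smul_self, coroot'_negIdx]
  have hr : P.reflection i (ofIdx P i • lam) = lam := by
    change ofIdx P i • ofIdx P i • lam = lam
    rw [← mul_smul, ofIdx_mul_self, one_smul]
  have hs : P.reflection i lam = ofIdx P i • lam := rfl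
  rw [divDiff_eq_stringSum, divDiff_eq_stringSum, hn, hr, hs]
  have h := stringSum_add (P.coroot' i lam) (-P.coroot' i lam)
    (fun k => x (lam - k • P.root i))
  rw [add_neg_cancel, stringSum_zero] at h
  have e : ∀ k : ℤ, lam - (k + P.coroot' i lam) • P.root i =
      ofIdx P i • lam - k • P.root i := by
    intro k
    rw [ofIdx_smul, add_smul]
    abel
  simp only [e] at h
  rw [eq_neg_of_add_eq_zero_right h.symm]
  abel

/-- The values on generators of the anti-involution `T_w ↦ T_{w⁻¹}`, `X^λ ↦ X^λ`. -/
def antiGen : Gen P → (HeckeRing b)ᵐᵒᵖ :=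
  Sum.elim (fun w => .op (elT b w⁻¹)) (fun lam => .op (elX b lam))

theorem antiGen_rel ⦃x y : FreeAlgebra R (Gen P)⦄ (h : Rel b x y) :
    FreeAlgebra.lift R (antiGen b) x = FreeAlgebra.lift R (antiGen b) y := by
  have hT : ∀ w, FreeAlgebra.lift R (antiGen b) (genT w) = .op (elT b w⁻¹) := fun w => by
    simp [genT, antiGen]
  have hX : ∀ lam, FreeAlgebra.lift R (antiGen b) (genX lam) = .op (elX b lam) := fun lam => by
    simp [genX, antiGen]
  induction h with
  | T_one => simp [hT, elT_one]
  | X_zero => simp [hX, elX_zero]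
  | X_add lam mu =>
    rw [map_mul, hX, hX, hX, ← MulOpposite.op_mul, ← elX_add, add_comm]
  | quadratic i hi =>
    rw [map_mul, map_add, map_sub, hT, map_one, AlgHom.commutes, ofIdx_inv, map_zero,
      MulOpposite.algebraMap_apply, ← MulOpposite.op_one, ← MulOpposite.op_add,
      ← MulOpposite.op_sub, ← MulOpposite.op_mul]
    have h := elT_quadratic b hi
    have hc := Algebra.commutes q (elT b (ofIdx P i))
    rw [MulOpposite.op_eq_zero_iff, ← h, sub_mul, mul_sub, mul_add, mul_add, add_mul, add_mul, hc]
    simp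
  | T_mul w y h =>
    rw [map_mul, hT, hT, hT, ← MulOpposite.op_mul, mul_inv_rev]
    rw [elT_mul]
    rw [← mul_inv_rev, len_inv, len_inv, len_inv, h, add_comm]
  | bernstein i hi lam =>
    rw [map_sub, map_mul, map_mul, hT, hX, hX, map_smul, map_divDiff, ofIdx_inv]
    simp only [hX]
    have e := map_divDiff (P := P) (MulOpposite.opAddEquiv (α := HeckeRing b)) (elX b) i lam
    simp only [MulOpposite.opAddEquiv_apply] at e
    rw [← e, ← MulOpposite.op_mul, ← MulOpposite.op_mul, ← MulOpposite.op_sub,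
      ← MulOpposite.op_smul]
    congr 1
    have h := elT_bernstein b hi (ofIdx P i • lam)
    rw [← mul_smul, ofIdx_mul_self, one_smul, divDiff_reflect] at h
    change _ - elT b (ofIdx P i) * elX b (ofIdx P i • lam) = _
    rw [h, smul_neg]
    abel

/-- The anti-involution `T_w ↦ T_{w⁻¹}`, `X^λ ↦ X^λ`. -/
def antiHom : HeckeRing b →ₐ[R] (HeckeRing b)ᵐᵒᵖ :=
  liftHecke b (FreeAlgebra.lift R (antiGen b)) (antiGen_rel b)

theorem antiHom_elT (w : P.weylGroup) : antiHom b (elT b w) = .op (elT b w⁻¹) := by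
  rw [antiHom, elT, liftHecke_toHecke]
  simp [genT, antiGen]

theorem antiHom_elX (lam : X) : antiHom b (elX b lam) = .op (elX b lam) := by
  rw [antiHom, elX, liftHecke_toHecke]
  simp [genX, antiGen, elX]

/-- The anti-involution as a linear map. -/
def antiLin : HeckeRing b →ₗ[R] HeckeRing b :=
  (MulOpposite.opLinearEquiv R).symm.toLinearMap ∘ₗ (antiHom b).toLinearMap

theorem antiLin_mul (x y : HeckeRing b) : antiLin b (x * y) = antiLin b y * antiLin b x := by
  simp [antiLin]

theorem antiLin_elT (w : P.weylGroup) : antiLin b (elT b w) = elT b w⁻¹ := by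
  simp [antiLin, antiHom_elT]

theorem antiLin_elX (lam : X) : antiLin b (elX b lam) = elX b lam := by
  simp [antiLin, antiHom_elX]

theorem antiLin_one : antiLin b 1 = 1 := by simp [antiLin]

theorem antiLin_involutive : Function.Involutive (antiLin b) := by
  intro a
  induction a using hecke_induction b with
  | hR r => rw [Algebra.algebraMap_eq_smul_one, map_smul, map_smul, antiLin_one, antiLin_one]
  | hT w => rw [antiLin_elT, antiLin_elT, inv_inv]
  | hX lam => rw [antiLin_elX, antiLin_elX]
  | hmul x y hx hy => rw [antiLin_mul, antiLin_mul, hx, hy]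
  | hadd x y hx hy => rw [map_add, map_add, hx, hy]

theorem antiLin_elTinv (w : P.weylGroup) : antiLin b (elTinv b w) = elTinv b w⁻¹ := by
  have h := congrArg (antiLin b) (elTinv_mul_elT b w)
  rw [antiLin_mul, antiLin_elT, inv_inv, antiLin_one] at h
  apply (isUnit_elT b w).mul_left_cancel
  rw [h]
  simpa using (elT_mul_elTinv b w⁻¹).symm

end HeckeAlgebra

/-! ### The action of the affine Hecke algebra on the alcove module -/

section Representation

variable {ι X Y : Type*} [AddCommGroup X] [AddCommGroup Y] {P : RootPairing ι ℤ X Y} (b : P.Base)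
  {S : Type*} [CommRing S] [Finite ι] [P.IsReduced]

/-- The operators that commute with everything that commutes with the simple generators. -/
def BiCommutes (z : S) (f : Module.End S ((P.weylGroup × X) →₀ S)) : Prop :=
  ∀ g, (∀ i ∈ b.support, Commute (tauOp z (fundPos b) i) g) → Commute f g

variable {b} in
omit [Finite ι] [P.IsReduced] in
theorem BiCommutes.mul {z : S} {f g : Module.End S ((P.weylGroup × X) →₀ S)}
    (hf : BiCommutes b z f) (hg : BiCommutes b z g) : BiCommutes b z (f * g) :=
  fun k hk => (hf k hk).mul_left (hg k hk)

variable {b} in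
omit [Finite ι] [P.IsReduced] in
theorem BiCommutes.add {z : S} {f g : Module.End S ((P.weylGroup × X) →₀ S)}
    (hf : BiCommutes b z f) (hg : BiCommutes b z g) : BiCommutes b z (f + g) :=
  fun k hk => (hf k hk).add_left (hg k hk)

variable {b} in
omit [Finite ι] [P.IsReduced] in
theorem BiCommutes.smul {z : S} {f : Module.End S ((P.weylGroup × X) →₀ S)}
    (hf : BiCommutes b z f) (c : S) : BiCommutes b z (c • f) :=
  fun k hk => (hf k hk).smul_left c

omit [Finite ι] [P.IsReduced] in
theorem biCommutes_one (z : S) :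
    BiCommutes b z (1 : Module.End S ((P.weylGroup × X) →₀ S)) :=
  fun k _ => Commute.one_left k

omit [Finite ι] [P.IsReduced] in
theorem biCommutes_tauOp (z : S) {i : ι} (hi : i ∈ b.support) :
    BiCommutes b z (tauOp z (fundPos b) i) :=
  fun _ hk => hk i hi

/-- Operators in the bicommutant of the simple generators agree as soon as they agree on the first
basis vector. -/
theorem BiCommutes.ext (hsc : Submodule.span ℤ (Set.range P.coroot) = ⊤) {z : S}
    {f g : Module.End S ((P.weylGroup × X) →₀ S)} (hf : BiCommutes b z f) (hg : BiCommutes b z g)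
    (h : f (ket S 1 0) = g (ket S 1 0)) : f = g := by
  apply end_ext
  intro w nu
  obtain ⟨k, h1, h2⟩ := exists_commuting_ket b z (exists_stepPath b hsc) w nu
  rw [← h2, ← Module.End.mul_apply, ← Module.End.mul_apply, (hf k h1).eq, (hg k h1).eq,
    Module.End.mul_apply, Module.End.mul_apply, h]

omit [Finite ι] [P.IsReduced] in
theorem tauOp_ket_zero_of_pos (z : S) {i : ι} {w : P.weylGroup} (h : b.IsPos (w⁻¹ • i)) :
    tauOp z (fundPos b) i (ket S w 0) = ket S (ofIdx P i * w) 0 := by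
  simp [tauOp, fundPos, h]

omit [Finite ι] [P.IsReduced] in
theorem tauOp_ket_zero_of_neg (z : S) {i : ι} {w : P.weylGroup} (h : ¬ b.IsPos (w⁻¹ • i)) :
    tauOp z (fundPos b) i (ket S w 0) = ket S (ofIdx P i * w) 0 + z • ket S w 0 := by
  simp [tauOp, fundPos, h]

/-- The quadratic relation, checked on the first basis vector. -/
theorem tauOp_sq (hsc : Submodule.span ℤ (Set.range P.coroot) = ⊤) (z : S) {i : ι}
    (hi : i ∈ b.support) : tauOp (P := P) z (fundPos b) i * tauOp z (fundPos b) i =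
      z • tauOp z (fundPos b) i + 1 := by
  have hτ := biCommutes_tauOp b z hi
  refine (hτ.mul hτ).ext b hsc ((hτ.smul z).add (biCommutes_one b z)) ?_
  have hpos := b.isPos_of_mem_support hi
  rw [Module.End.mul_apply, LinearMap.add_apply, LinearMap.smul_apply,
    tauOp_ket_zero_of_pos b z (by simpa using hpos), mul_one, tauOp_ket_zero_of_neg b z
      (by rwa [ofIdx_inv, ofIdx_smul_self, isPos_negIdx, not_not]), ofIdx_mul_self, add_comm]
  rfl

theorem quadratic_inverse_left {A : Type*} [Ring A] [Algebra S A] {z : S} {t : A}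
    (h : t * t = z • t + 1) : t * (t - z • 1) = 1 := by
  rw [mul_sub, h, mul_smul_comm, mul_one, add_sub_cancel_left]

theorem quadratic_inverse_right {A : Type*} [Ring A] [Algebra S A] {z : S} {t : A}
    (h : t * t = z • t + 1) : (t - z • 1) * t = 1 := by
  rw [sub_mul, h, smul_mul_assoc, one_mul, add_sub_cancel_left]

/-- The quadratic relation for the rescaled inverse of `t`. -/
theorem quadratic_rescale {A : Type*} [Ring A] [Algebra S A] {z v : S} {t : A}
    (h : t * t = z • t + 1) (hv : v * z = 1 - v * v) :
    (v • (t - z • 1) + 1) * (v • (t - z • 1) - (v * v) • 1) = 0 := by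
  have h1 : (v • (t - z • 1)) * (v • (t - z • 1)) = (v * v) • ((1 : A) - z • (t - z • 1)) := by
    rw [smul_mul_smul_comm, mul_sub, quadratic_inverse_right h, mul_smul_comm, mul_one]
  rw [add_mul, mul_sub, h1, one_mul, mul_smul_comm, mul_one, smul_sub (v * v), smul_smul (v * v),
    mul_assoc v v z, hv]
  module

open Classical in
/-- The simple generators as units. -/
def tauUnit (hsc : Submodule.span ℤ (Set.range P.coroot) = ⊤) (z : S) (i : ι) :
    (Module.End S ((P.weylGroup × X) →₀ S))ˣ :=
  if hi : i ∈ b.support then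
    { val := tauOp z (fundPos b) i
      inv := tauOp z (fundPos b) i - z • 1
      val_inv := quadratic_inverse_left (A := Module.End S ((P.weylGroup × X) →₀ S))
        (tauOp_sq b hsc z hi)
      inv_val := quadratic_inverse_right (A := Module.End S ((P.weylGroup × X) →₀ S))
        (tauOp_sq b hsc z hi) }
  else 1

variable (hsc : Submodule.span ℤ (Set.range P.coroot) = ⊤)

theorem tauUnit_val (z : S) {i : ι} (hi : i ∈ b.support) :
    (tauUnit b hsc z i).val = tauOp z (fundPos b) i := by
  rw [tauUnit, dif_pos hi]

theorem tauUnit_inv_val (z : S) {i : ι} (hi : i ∈ b.support) :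
    (tauUnit b hsc z i)⁻¹.val = tauOp z (fundPos b) i - z • 1 := by
  rw [tauUnit, dif_pos hi]
  rfl

/-- The product of the simple generators along a word. -/
def wordUnit (z : S) (L : List ι) : (Module.End S ((P.weylGroup × X) →₀ S))ˣ :=
  (L.map (tauUnit b hsc z)).prod

theorem wordUnit_biCommutes (z : S) {L : List ι} (hL : ∀ i ∈ L, i ∈ b.support) :
    BiCommutes b z (wordUnit b hsc z L).val := by
  induction L with
  | nil => exact biCommutes_one b z
  | cons i L ih =>
    rw [wordUnit, List.map_cons, List.prod_cons, Units.val_mul,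
      tauUnit_val b hsc z (hL i (by simp))]
    exact (biCommutes_tauOp b z (hL i (by simp))).mul (ih fun k hk => hL k (by simp [hk]))

theorem wordUnit_ket (z : S) {L : List ι} (hL : ∀ i ∈ L, i ∈ b.support)
    (hred : L.length = len b (L.map (ofIdx P)).prod) :
    (wordUnit b hsc z L).val (ket S 1 0) = ket S (L.map (ofIdx P)).prod 0 := by
  induction L with
  | nil => rfl
  | cons i L ih =>
    have hi : i ∈ b.support := hL i (by simp)
    have hL' : ∀ k ∈ L, k ∈ b.support := fun k hk => hL k (by simp [hk])
    have h1 := len_le_length b (P := P) hL'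
    rw [List.map_cons, List.prod_cons, List.length_cons] at hred
    have hpos : b.IsPos ((L.map (ofIdx P)).prod⁻¹ • i) := by
      by_contra h
      have := len_simple_mul_of_neg b hi h
      omega
    have h2 := len_simple_mul_of_pos b hi hpos
    rw [wordUnit, List.map_cons, List.prod_cons, Units.val_mul, tauUnit_val b hsc z hi,
      Module.End.mul_apply]
    change tauOp z (fundPos b) i ((wordUnit b hsc z L).val _) = _
    rw [ih hL' (by omega), tauOp_ket_zero_of_pos b z hpos, List.map_cons, List.prod_cons]

/-- The operator of `q^{ℓ(w)/2} T_{w⁻¹}⁻¹`. -/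
def weylUnit (z : S) (w : P.weylGroup) : (Module.End S ((P.weylGroup × X) →₀ S))ˣ :=
  wordUnit b hsc z (exists_reduced_word b w).choose

theorem weylUnit_biCommutes (z : S) (w : P.weylGroup) :
    BiCommutes b z (weylUnit b hsc z w).val :=
  wordUnit_biCommutes b hsc z (exists_reduced_word b w).choose_spec.1

theorem weylUnit_ket (z : S) (w : P.weylGroup) :
    (weylUnit b hsc z w).val (ket S 1 0) = ket S w 0 := by
  obtain ⟨h1, h2, h3⟩ := (exists_reduced_word b w).choose_spec
  have := wordUnit_ket b hsc z h1 (by rw [h3, h2])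
  rwa [h3] at this

/-- The product along a reduced word depends only on the element of the Weyl group, since its value
on the first basis vector does. -/
theorem wordUnit_eq_weylUnit (z : S) {L : List ι} (hL : ∀ i ∈ L, i ∈ b.support)
    (hred : L.length = len b (L.map (ofIdx P)).prod) :
    wordUnit b hsc z L = weylUnit b hsc z (L.map (ofIdx P)).prod := by
  apply Units.ext
  refine (wordUnit_biCommutes b hsc z hL).ext b hsc (weylUnit_biCommutes b hsc z _) ?_
  rw [wordUnit_ket b hsc z hL hred, weylUnit_ket]

theorem weylUnit_mul (z : S) {w y : P.weylGroup} (h : len b (w * y) = len b w + len b y) :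
    weylUnit b hsc z (w * y) = weylUnit b hsc z w * weylUnit b hsc z y := by
  obtain ⟨L, h1, h2, rfl⟩ := exists_reduced_word b w
  obtain ⟨L', h3, h4, rfl⟩ := exists_reduced_word b y
  have h5 : ((L ++ L').map (ofIdx P)).prod = (L.map (ofIdx P)).prod * (L'.map (ofIdx P)).prod := by
    rw [List.map_append, List.prod_append]
  rw [← wordUnit_eq_weylUnit b hsc z h1 h2, ← wordUnit_eq_weylUnit b hsc z h3 h4, ← h5,
    ← wordUnit_eq_weylUnit b hsc z]
  · rw [wordUnit, List.map_append, List.prod_append]; rfl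
  · intro i hi
    rcases List.mem_append.1 hi with hi | hi
    exacts [h1 i hi, h3 i hi]
  · rw [h5, h, List.length_append, h2, h4]

theorem weylUnit_simple (z : S) {i : ι} (hi : i ∈ b.support) :
    weylUnit b hsc z (ofIdx P i) = tauUnit b hsc z i := by
  have := wordUnit_eq_weylUnit b hsc z (L := [i]) (by simpa using hi)
    (by simp [len_simple b hi])
  simpa [wordUnit] using this.symm

theorem weylUnit_one (z : S) : weylUnit b hsc z (1 : P.weylGroup) = 1 := by
  have := weylUnit_mul b hsc z (w := (1 : P.weylGroup)) (y := 1) (by simp)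
  simpa using this

omit [Finite ι] [P.IsReduced] in
theorem leftOp_add (x y : X) :
    leftOp (P := P) (S := S) (x + y) = leftOp x * leftOp y := by
  apply end_ext
  intro w nu
  simp [leftOp, add_assoc]

omit [Finite ι] [P.IsReduced] in
theorem leftOp_zero : leftOp (P := P) (S := S) 0 = 1 := by
  apply end_ext
  intro w nu
  simp [leftOp]

/-- The parameter `q^{-1/2} - q^{1/2}`. -/
def zPar (v : Sˣ) : S := (↑v⁻¹ : S) - v

/-- The operators of the generators: `T_w` acts by `q^{ℓ(w)/2}` times the inverse of the unit of
`w⁻¹`. -/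
def repGen (v : Sˣ) : Gen P → Module.End S ((P.weylGroup × X) →₀ S) :=
  Sum.elim (fun w => ((v ^ len b w : Sˣ) : S) • (weylUnit b hsc (zPar v) w⁻¹)⁻¹.val) leftOp

variable [Algebra R S] (v : Sˣ)
  (hv : ∀ n : ℤ, algebraMap R S (LaurentPolynomial.T n) = ((v ^ (2 * n) : Sˣ) : S))

include hv in
omit [Finite ι] [P.IsReduced] in
theorem algebraMap_q : algebraMap R S q = (v : S) * v := by
  rw [q, hv, ← Units.val_mul]
  congr 1
  rw [mul_one, zpow_two]

include hv in
theorem repGen_rel ⦃x y : FreeAlgebra R (Gen P)⦄ (h : Rel b x y) :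
    FreeAlgebra.lift R (repGen b hsc v) x = FreeAlgebra.lift R (repGen b hsc v) y := by
  have hT : ∀ w, FreeAlgebra.lift R (repGen b hsc v) (genT w) =
      ((v ^ len b w : Sˣ) : S) • (weylUnit b hsc (zPar v) w⁻¹)⁻¹.val := fun w => by
    simp [genT, repGen]
  have hX : ∀ lam, FreeAlgebra.lift R (repGen b hsc v) (genX lam) = leftOp lam := fun lam => by
    simp [genX, repGen]
  have hq := algebraMap_q v hv
  have hTs : ∀ i ∈ b.support, FreeAlgebra.lift R (repGen b hsc v) (genT (ofIdx P i)) =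
      (v : S) • (tauOp (zPar v) (fundPos b) i - zPar v • 1) := fun i hi => by
    rw [hT, ofIdx_inv, weylUnit_simple b hsc _ hi, tauUnit_inv_val b hsc _ hi, len_simple b hi,
      pow_one]
  have hvz : (v : S) * zPar v = 1 - v * v := by rw [zPar, mul_sub, Units.mul_inv]
  induction h with
  | T_one => rw [hT, inv_one, weylUnit_one, map_one, len_one]; simp
  | X_zero => rw [hX, map_one, leftOp_zero]
  | X_add lam mu => rw [map_mul, hX, hX, hX, leftOp_add]
  | quadratic i hi =>
    rw [map_mul, map_add, map_sub, hTs i hi, map_one, AlgHom.commutes, map_zero,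
      IsScalarTower.algebraMap_apply R S, hq, Algebra.algebraMap_eq_smul_one]
    exact quadratic_rescale (A := Module.End S ((P.weylGroup × X) →₀ S))
      (tauOp_sq b hsc (zPar v) hi) hvz
  | T_mul w y h =>
    rw [map_mul, hT, hT, hT, mul_inv_rev, weylUnit_mul b hsc, mul_inv_rev, Units.val_mul, h,
      pow_add, Units.val_mul, smul_mul_smul_comm]
    rw [← mul_inv_rev, len_inv, len_inv, len_inv, h, add_comm]
  | bernstein i hi lam =>
    rw [map_sub, map_mul, map_mul, hTs i hi, hX, hX, map_smul, map_divDiff]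
    simp only [hX]
    rw [← algebraMap_smul S (1 - q), map_sub, map_one, hq, ← hvz, divDiff_eq_stringSum]
    have h1 := tauOp_comp_leftOp (S := S) (P := P) (zPar v) (fundPos b) i lam
    have h2 : P.reflection i lam = ofIdx P i • lam := rfl
    have h3 : (tauOp (zPar v) (fundPos b) i - zPar v • 1) * leftOp lam =
        tauOp (zPar v) (fundPos b) i * leftOp lam - zPar v • leftOp (P := P) (S := S) lam :=
      LinearMap.sub_comp _ _ _
    have h4 : leftOp (ofIdx P i • lam) * (tauOp (zPar v) (fundPos b) i - zPar v • 1) =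
        leftOp (ofIdx P i • lam) * tauOp (zPar v) (fundPos b) i -
          zPar v • leftOp (P := P) (S := S) (ofIdx P i • lam) := by
      refine (LinearMap.comp_sub _ _ _).trans ?_
      congr 1
      exact mul_smul_comm _ _ _
    rw [h2, smul_mul_assoc, mul_smul_comm, h3, h1, h4]
    module

/-- The action of the affine Hecke algebra on the alcove module. -/
def rep : HeckeRing b →ₐ[R] Module.End S ((P.weylGroup × X) →₀ S) :=
  liftHecke b (FreeAlgebra.lift R (repGen b hsc v)) (repGen_rel b hsc v hv)

theorem rep_elT (w : P.weylGroup) : rep b hsc v hv (elT b w) =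
    ((v ^ len b w : Sˣ) : S) • (weylUnit b hsc (zPar v) w⁻¹)⁻¹.val := by
  rw [rep, elT, liftHecke_toHecke]
  simp [genT, repGen]

theorem rep_elX (lam : X) : rep b hsc v hv (elX b lam) = leftOp lam := by
  rw [rep, elX, liftHecke_toHecke]
  simp [genX, repGen]

theorem rep_elTinv (w : P.weylGroup) : rep b hsc v hv (elTinv b w) =
    (((v ^ len b w)⁻¹ : Sˣ) : S) • (weylUnit b hsc (zPar v) w).val := by
  have h := congrArg (rep b hsc v hv) (elT_mul_elTinv b w)
  rw [map_mul, rep_elT, map_one, inv_inv, len_inv] at h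
  have h2 := congrArg
    (((((v ^ len b w)⁻¹ : Sˣ) : S) • (weylUnit b hsc (zPar v) w).val) * ·) h
  simp only [mul_one] at h2
  rw [← h2, ← mul_assoc, smul_mul_smul_comm, Units.inv_mul, Units.mul_inv, one_smul, one_mul]

theorem rep_elX_mul_elTinv_ket (u : P.weylGroup) (mu : X) :
    rep b hsc v hv (elX b mu * elTinv b u) (ket S 1 0) =
      (((v ^ len b u)⁻¹ : Sˣ) : S) • ket S u mu := by
  rw [map_mul, rep_elX, rep_elTinv, Module.End.mul_apply, LinearMap.smul_apply, weylUnit_ket,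
    map_smul, leftOp, ofKet_ket, add_zero]

/-- The action of a product `T_{w⁻¹}⁻¹ X^y` on the first basis vector, in terms of the operator of
a path from the fundamental alcove to its translate by `y`. -/
theorem rep_elTinv_mul_elX_ket {L : List (ι × ℤ)} {y : X}
    (hL : StepPath P (fundPos b) L (fun γ => fundPos b γ + P.coroot' γ y)) (w : P.weylGroup) :
    rep b hsc v hv (elTinv b w * elX b y) (ket S 1 0) =
      (((v ^ len b w)⁻¹ : Sˣ) : S) • transOp y (pathOp b (zPar v) L (ket S w 0)) := by
  have hcomm : ∀ i ∈ b.support, Commute (tauOp (zPar v) (fundPos b) i)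
      (transOp y * pathOp b (zPar v) L : Module.End S ((P.weylGroup × X) →₀ S)) := by
    intro i hi
    rw [Commute, SemiconjBy, ← mul_assoc, tauOp_comp_transOp, mul_assoc,
      tauOp_comp_pathOp b _ hL hi, mul_assoc]
  have h1 : leftOp y (ket S (1 : P.weylGroup) 0) =
      (transOp y * pathOp b (zPar v) L : Module.End S ((P.weylGroup × X) →₀ S)) (ket S 1 0) := by
    rw [Module.End.mul_apply, pathOp_ket_one]
    simp [leftOp, transOp]
  rw [map_mul, rep_elX, rep_elTinv, Module.End.mul_apply, h1, LinearMap.smul_apply,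
    ← Module.End.mul_apply, (weylUnit_biCommutes b hsc (zPar v) w _ hcomm).eq,
    Module.End.mul_apply, weylUnit_ket, Module.End.mul_apply]

/-- The elements `X^μ T_{u⁻¹}⁻¹` send the first basis vector to unit multiples of the basis
vectors. -/
theorem rep_linearCombination_ket (c : (P.weylGroup × X) →₀ R) (g : P.weylGroup × X) :
    rep b hsc v hv (Finsupp.linearCombination R
      (fun g : P.weylGroup × X => elX b g.2 * elTinv b g.1) c) (ket S 1 0) g =
      (((v ^ len b g.1)⁻¹ : Sˣ) : S) * algebraMap R S (c g) := by
  classical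
  induction c using Finsupp.induction_linear with
  | zero => simp
  | add c c' h h' =>
    rw [map_add, map_add, LinearMap.add_apply, Finsupp.add_apply, h, h', Finsupp.add_apply, map_add,
      mul_add]
  | single k r =>
    obtain ⟨k1, k2⟩ := k
    rw [Finsupp.linearCombination_single, map_smul, LinearMap.smul_apply, rep_elX_mul_elTinv_ket,
      ket, Finsupp.smul_apply, Finsupp.smul_apply, Finsupp.single_apply, Finsupp.single_apply]
    split_ifs with h
    · rw [← h, Algebra.smul_def, smul_eq_mul, mul_one, mul_comm]
    · simp

include hsc hv in
theorem linearIndependent_elX_mul_elTinv (hinj : Function.Injective (algebraMap R S)) :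
    LinearIndependent R (fun g : P.weylGroup × X => elX b g.2 * elTinv b g.1) := by
  rw [linearIndependent_iff]
  intro c hc
  ext1 g
  have h := rep_linearCombination_ket b hsc v hv c g
  rw [hc, map_zero, LinearMap.zero_apply, Finsupp.zero_apply] at h
  have h2 : algebraMap R S (c g) = 0 := by
    rw [← (Units.mul_right_eq_zero ((v ^ len b g.1)⁻¹))]
    exact h.symm
  exact hinj (h2.trans (map_zero _).symm)

end Representation

/-! ### The ring with a square root of `q` -/

/-- The ring `ℤ[v, v⁻¹]`, where `v² = q`. -/
def HalfRing : Type := ℤ[T;T⁻¹]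

instance : CommRing HalfRing := inferInstanceAs (CommRing ℤ[T;T⁻¹])

/-- The inclusion `q ↦ v²`. -/
def halfHom : R →+* HalfRing :=
  (AddMonoidAlgebra.mapDomainRingHom ℤ (AddMonoidHom.mulLeft (2 : ℤ)) : R →+* ℤ[T;T⁻¹])

instance : Algebra R HalfRing := halfHom.toAlgebra

theorem algebraMap_halfRing_injective : Function.Injective (algebraMap R HalfRing) := by
  have : Function.Injective fun x : ℤ => 2 * x := fun x y h => by
    simpa using h
  exact AddMonoidAlgebra.mapDomain_injective this

/-- The unit `v = q^{1/2}`. -/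
def vUnit : HalfRingˣ :=
  ⟨(LaurentPolynomial.T 1 : ℤ[T;T⁻¹]), (LaurentPolynomial.T (-1) : ℤ[T;T⁻¹]),
    (LaurentPolynomial.T_add 1 (-1)).symm, (LaurentPolynomial.T_add (-1) 1).symm⟩

theorem vUnit_zpow (n : ℤ) :
    ((vUnit ^ n : HalfRingˣ) : HalfRing) = (LaurentPolynomial.T n : ℤ[T;T⁻¹]) := by
  induction n using Int.induction_on with
  | zero => rfl
  | succ n ih =>
    rw [zpow_add_one, Units.val_mul, ih]
    exact (LaurentPolynomial.T_add _ _).symm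
  | pred n ih =>
    rw [zpow_sub_one, Units.val_mul, ih]
    exact (LaurentPolynomial.T_add _ _).symm

theorem algebraMap_T (n : ℤ) :
    algebraMap R HalfRing (LaurentPolynomial.T n) = ((vUnit ^ (2 * n) : HalfRingˣ) : HalfRing) := by
  rw [vUnit_zpow]
  exact AddMonoidAlgebra.mapDomain_single

section Basis

variable {ι X Y : Type*} [AddCommGroup X] [AddCommGroup Y] {P : RootPairing ι ℤ X Y} (b : P.Base)
  [Finite ι] [P.IsReduced] (hsc : Submodule.span ℤ (Set.range P.coroot) = ⊤)

/-- The basis of the elements `X^μ T_{u⁻¹}⁻¹`. -/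
def basisXT : Module.Basis (P.weylGroup × X) R (HeckeRing b) :=
  .mk (linearIndependent_elX_mul_elTinv b hsc vUnit algebraMap_T algebraMap_halfRing_injective)
    (span_elX_mul_elTinv b).ge

theorem basisXT_apply (u : P.weylGroup) (mu : X) :
    basisXT b hsc (u, mu) = elX b mu * elTinv b u := by
  simp [basisXT]

/-- The basis of the elements `T_{w⁻¹}⁻¹ X^λ`, the image of the other one under the
anti-involution. -/
def basisTX : Module.Basis (P.weylGroup × X) R (HeckeRing b) :=
  ((basisXT b hsc).map (LinearEquiv.ofInvolutive (antiLin b) (antiLin_involutive b))).reindex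
    ((Equiv.inv P.weylGroup).prodCongr (Equiv.refl X))

theorem basisTX_apply (w : P.weylGroup) (lam : X) :
    basisTX b hsc (w, lam) = elTinv b w * elX b lam := by
  rw [basisTX, Module.Basis.reindex_apply, Module.Basis.map_apply]
  change antiLin b (basisXT b hsc (w⁻¹, lam)) = _
  rw [basisXT_apply, antiLin_mul, antiLin_elTinv, antiLin_elX, inv_inv]

/-- The coefficients in the basis `X^μ T_{u⁻¹}⁻¹`, read off from the action on the first basis
vector of the alcove module. -/
theorem algebraMap_basisXT_repr (a : HeckeRing b) (g : P.weylGroup × X) :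
    algebraMap R HalfRing ((basisXT b hsc).repr a g) =
      ((vUnit ^ len b g.1 : HalfRingˣ) : HalfRing) *
        rep b hsc vUnit algebraMap_T a (ket HalfRing 1 0) g := by
  have h := rep_linearCombination_ket b hsc vUnit algebraMap_T ((basisXT b hsc).repr a) g
  have h2 : Finsupp.linearCombination R (fun g : P.weylGroup × X => elX b g.2 * elTinv b g.1)
      ((basisXT b hsc).repr a) = a := by
    have h3 := (basisXT b hsc).linearCombination_repr a
    rw [basisXT, Module.Basis.coe_mk] at h3
    exact h3
  rw [h2] at h
  rw [h, ← mul_assoc, Units.mul_inv, one_mul]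

end Basis

/-! ### Subsets of a chain and the two sums -/

section Subsets

theorem sort_ge_eq_reverse {l : ℕ} (J : Finset (Fin l)) :
    J.sort (· ≥ ·) = (J.sort (· ≤ ·)).reverse := by
  refine List.Perm.eq_of_pairwise' (J.pairwise_sort _) ?_ ?_
  · rw [List.pairwise_reverse]
    exact J.pairwise_sort (· ≤ ·)
  · exact (J.sort_perm_toList _).trans
      ((J.sort_perm_toList _).symm.trans (List.reverse_perm _).symm)

theorem sort_map_succ {l : ℕ} (J : Finset (Fin l)) :
    (J.map (Fin.succEmb l)).sort (· ≤ ·) = (J.sort (· ≤ ·)).map Fin.succ :=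
  (Finset.map_sort (f := Fin.succEmb l) J _ _ fun _ _ _ _ => Fin.succ_le_succ_iff.symm).symm

theorem zero_notMem_map_succ {l : ℕ} (J : Finset (Fin l)) :
    (0 : Fin (l + 1)) ∉ J.map (Fin.succEmb l) := by
  simp [Fin.succ_ne_zero]

theorem sort_insert_zero {l : ℕ} (J : Finset (Fin l)) :
    (insert 0 (J.map (Fin.succEmb l))).sort (· ≤ ·) = 0 :: (J.sort (· ≤ ·)).map Fin.succ := by
  rw [Finset.sort_insert _ (fun b _ => Fin.zero_le b) (zero_notMem_map_succ J), sort_map_succ]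

/-- A sum over the subsets of `Fin (l + 1)`, split according to whether they contain `0`. -/
theorem sum_finset_fin_succ {A : Type*} [AddCommMonoid A] {l : ℕ}
    (f : Finset (Fin (l + 1)) → A) :
    ∑ J, f J = ∑ J : Finset (Fin l), f (J.map (Fin.succEmb l)) +
      ∑ J : Finset (Fin l), f (insert 0 (J.map (Fin.succEmb l))) := by
  classical
  have key : ∀ J : Finset (Fin (l + 1)),
      (Finset.univ.filter fun j : Fin l => j.succ ∈ J).map (Fin.succEmb l) = J.erase 0 := by
    intro J
    ext j
    cases j using Fin.cases with
    | zero => simp [Fin.succ_ne_zero]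
    | succ j => simp [Fin.succ_ne_zero]
  have key2 : ∀ J : Finset (Fin l), (Finset.univ.filter fun j : Fin l =>
      j.succ ∈ J.map (Fin.succEmb l)) = J := fun J => by ext j; simp
  have key3 : ∀ J : Finset (Fin l), (Finset.univ.filter fun j : Fin l =>
      j.succ ∈ insert 0 (J.map (Fin.succEmb l))) = J := fun J => by ext j; simp [Fin.succ_ne_zero]
  rw [← Finset.sum_filter_not_add_sum_filter Finset.univ (fun J => (0 : Fin (l + 1)) ∈ J)]
  congr 1
  · refine Finset.sum_nbij' (fun J => Finset.univ.filter fun j : Fin l => j.succ ∈ J)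
      (fun J => J.map (Fin.succEmb l)) (by simp) (fun J _ => ?_) (fun J hJ => ?_)
      (fun J _ => key2 J) (fun J hJ => ?_)
    · simp
    all_goals
      have h0 : 0 ∉ J := by simpa using hJ
      simp only [key, Finset.erase_eq_of_notMem h0]
  · refine Finset.sum_nbij' (fun J => Finset.univ.filter fun j : Fin l => j.succ ∈ J)
      (fun J => insert 0 (J.map (Fin.succEmb l))) (by simp) (fun J _ => by simp) (fun J hJ => ?_)
      (fun J _ => key3 J) (fun J hJ => ?_)
    all_goals
      have h0 : 0 ∈ J := by simpa using hJ
      simp only [key, Finset.insert_erase h0]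

variable {ι X Y : Type*} [AddCommGroup X] [AddCommGroup Y] {P : RootPairing ι ℤ X Y} (b : P.Base)

theorem bruhatChain_append_singleton {u w : P.weylGroup} {L : List ι} {i : ι} :
    BruhatChain b u (L ++ [i]) w ↔
      BruhatChain b u L (w * ofIdx P i) ∧ BruhatLT b (w * ofIdx P i) w := by
  induction L generalizing u with
  | nil =>
    simp only [List.nil_append, BruhatChain]
    constructor
    · rintro ⟨h, rfl⟩
      rw [mul_assoc, ofIdx_mul_self, mul_one]
      exact ⟨rfl, h⟩
    · rintro ⟨rfl, h⟩
      rw [mul_assoc, ofIdx_mul_self, mul_one]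
      exact ⟨h, rfl⟩
  | cons j L ih =>
    simp only [List.cons_append, BruhatChain, ih, and_assoc]

theorem bruhatChain_map_negIdx {u w : P.weylGroup} {L : List ι} :
    BruhatChain b u (L.map (negIdx P)) w ↔ BruhatChain b u L w := by
  induction L generalizing u with
  | nil => rfl
  | cons j L ih => simp only [List.map_cons, BruhatChain, ih, ofIdx_negIdx]

/-- Each reflection changes the parity of the length. -/
theorem BruhatChain.even [Finite ι] [P.IsReduced] [Module.Finite ℤ Y] {u w : P.weylGroup}
    {L : List ι} (h : BruhatChain b u L w) : Even (len b u + len b w + L.length) := by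
  induction L generalizing u with
  | nil => obtain rfl : u = w := h; simp
  | cons j L ih =>
    have h1 := ih h.2
    have h2 := len_mul_ofIdx_parity b u j
    rw [List.length_cons]
    grind

variable {l : ℕ} (β : Fin (l + 1) → ι) (d : Fin (l + 1) → ℤ) (J : Finset (Fin l))

theorem chainDesc_map_succ (u w : P.weylGroup) :
    ChainDesc b β (J.map (Fin.succEmb l)) u w ↔ ChainDesc b (fun j => β j.succ) J u w := by
  rw [ChainDesc, ChainDesc, sort_ge_eq_reverse, sort_ge_eq_reverse, sort_map_succ,
    ← List.map_reverse, List.map_map]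
  rfl

theorem chainDesc_insert_zero (u w : P.weylGroup) :
    ChainDesc b β (insert 0 (J.map (Fin.succEmb l))) u w ↔
      ChainDesc b (fun j => β j.succ) J u (w * ofIdx P (β 0)) ∧
        BruhatLT b (w * ofIdx P (β 0)) w := by
  rw [ChainDesc, ChainDesc, sort_ge_eq_reverse, sort_ge_eq_reverse, sort_insert_zero,
    List.reverse_cons, List.map_append, List.map_singleton, bruhatChain_append_singleton,
    ← List.map_reverse, List.map_map]
  rfl

theorem rHat_map_succ (x : X) :
    rHat P β d (J.map (Fin.succEmb l)) x = rHat P (fun j => β j.succ) (fun j => d j.succ) J x := by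
  rw [rHat, rHat, sort_map_succ, List.foldr_map]

theorem smul_rHat_insert_zero (w : P.weylGroup) (x : X) :
    w • rHat P β d (insert 0 (J.map (Fin.succEmb l))) x =
      (w * ofIdx P (β 0)) • rHat P (fun j => β j.succ) (fun j => d j.succ) J x -
        d 0 • P.root (w • β 0) := by
  rw [rHat, rHat, sort_insert_zero, List.foldr_cons, List.foldr_map, affRefl, root_negIdx, mul_smul]
  change w • (ofIdx P (negIdx P (β 0)) •
    rHat P (fun j => β j.succ) (fun j => d j.succ) J x + d 0 • -P.root (β 0)) = _
  rw [ofIdx_negIdx, smul_add, smul_neg, smul_neg, smul_comm w (d 0), ← root_weyl_smul,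
    sub_eq_add_neg]
  rfl

theorem nNeg_eq_card [DecidablePred fun i => b.IsPos i] {l : ℕ} (β : Fin l → ι)
    (J : Finset (Fin l)) : nNeg b β J = (J.filter fun j => ¬ b.IsPos (β j)).card := by
  rw [nNeg, ← Set.ncard_coe_finset]
  congr 1
  ext j
  simp

theorem nNeg_map_succ :
    nNeg b β (J.map (Fin.succEmb l)) = nNeg b (fun j => β j.succ) J := by
  classical
  rw [nNeg_eq_card, nNeg_eq_card, Finset.filter_map, Finset.card_map]
  rfl

open Classical in
theorem nNeg_insert_zero :
    nNeg b β (insert 0 (J.map (Fin.succEmb l))) =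
      nNeg b (fun j => β j.succ) J + if b.IsPos (β 0) then 0 else 1 := by
  rw [← nNeg_map_succ b β, nNeg_eq_card, nNeg_eq_card, Finset.filter_insert]
  split_ifs with h1
  · rfl
  · rw [Finset.card_insert_of_notMem (by simp [Fin.succ_ne_zero])]

end Subsets

/-! ### The operator of a path as a sum over subsets -/

section PathSum

variable {ι X Y : Type*} [AddCommGroup X] [AddCommGroup Y] {P : RootPairing ι ℤ X Y} (b : P.Base)
  {S : Type*} [CommRing S]

open Classical in
/-- Expanding the product of the crossing operators, `J` being the set of the places where a folding
occurs. -/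
theorem transOp_pathOp_ket_apply (z : S) (y : X) {l : ℕ} (β : Fin l → ι) (d : Fin l → ℤ)
    (w u : P.weylGroup) (nu mu : X) :
    transOp y (pathOp b z (List.ofFn fun j => (β j, d j)) (ket S w nu)) (u, mu) =
      ∑ J : Finset (Fin l) with ChainDesc b β J u w ∧ nu + w • rHat P β d J y = mu,
        (-1) ^ nNeg b β J * z ^ J.card := by
  induction l generalizing w nu with
  | zero =>
    rw [Finset.sum_filter, Fintype.sum_unique]
    have h1 : (default : Finset (Fin 0)) = ∅ := rfl
    have h2 : nNeg b β ∅ = 0 := by rw [nNeg_eq_card]; rfl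
    rw [h1, h2, List.ofFn_zero, pathOp, Module.End.one_apply, transOp, ofKet_ket, ket,
      Finsupp.single_apply]
    simp [ChainDesc, BruhatChain, rHat, eq_comm]
  | succ l ih =>
    rw [List.ofFn_succ, pathOp, Module.End.mul_apply, foldOp, ofKet_ket, map_add, map_add, map_smul,
      map_smul, Finsupp.add_apply, Finsupp.smul_apply, ih, ih, Finset.sum_filter, Finset.sum_filter,
      Finset.sum_filter, sum_finset_fin_succ, smul_eq_mul, Finset.mul_sum]
    congr 1
    · refine Finset.sum_congr rfl fun J _ => ?_
      rw [nNeg_map_succ, Finset.card_map]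
      simp only [chainDesc_map_succ, rHat_map_succ]
    · refine Finset.sum_congr rfl fun J _ => ?_
      rw [nNeg_insert_zero, Finset.card_insert_of_notMem (zero_notMem_map_succ J), Finset.card_map]
      simp only [chainDesc_insert_zero, smul_rHat_insert_zero]
      have e : ∀ x : X, nu + (x - d 0 • P.root (w • β 0)) = nu - d 0 • P.root (w • β 0) + x :=
        fun x => by abel
      rw [e, foldSign]
      by_cases h : BruhatLT b (w * ofIdx P (β 0)) w
      · simp only [h, and_true, if_true]
        split_ifs <;> ring
      · simp [h]

/-- The half-integral power of `q` that goes with `t` reflections, in terms of `v = q^{1/2}`. The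
parity makes the integer division in `qPow` exact. -/
theorem map_chain_term {u w : P.weylGroup} {t : ℕ} (h : Even (len b u + len b w + t)) :
    algebraMap R HalfRing ((1 - q) ^ t * qPow b u w t) =
      ((vUnit ^ len b u : HalfRingˣ) : HalfRing) * (((vUnit ^ len b w)⁻¹ : HalfRingˣ) : HalfRing) *
        zPar vUnit ^ t := by
  have h1 : 2 * (((len b u : ℤ) - (len b w : ℤ) - (t : ℤ)) / 2) =
      (len b u : ℤ) - (len b w : ℤ) - (t : ℤ) := by
    obtain ⟨k, hk⟩ := h
    omega
  have h2 : (vUnit ^ ((len b u : ℤ) - (len b w : ℤ) - (t : ℤ)) : HalfRingˣ) =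
      vUnit ^ len b u * (vUnit ^ len b w)⁻¹ * vUnit⁻¹ ^ t := by
    rw [zpow_sub, zpow_sub, zpow_natCast, zpow_natCast, zpow_natCast, inv_pow]
  have h3 : zPar vUnit = ((vUnit⁻¹ : HalfRingˣ) : HalfRing) * (1 - vUnit * vUnit) := by
    rw [zPar, mul_sub, mul_one, ← mul_assoc, Units.inv_mul, one_mul]
  rw [map_mul, map_pow, map_sub, map_one, algebraMap_q vUnit algebraMap_T, qPow, algebraMap_T, h1,
    h2, h3, mul_pow, Units.val_mul, Units.val_mul, Units.val_pow_eq_pow_val (vUnit⁻¹)]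
  ring

/-- The first sum is a matrix coefficient of the operator of the chain. -/
theorem algebraMap_chainSumNeg [Finite ι] [P.IsReduced] [Module.Finite ℤ Y] (lam : X) {l : ℕ}
    (β : Fin l → ι) (d : Fin l → ℤ) (w u : P.weylGroup) (mu : X) :
    algebraMap R HalfRing (chainSumNeg b lam β d w u mu) =
      ((vUnit ^ len b u : HalfRingˣ) : HalfRing) *
        ((((vUnit ^ len b w)⁻¹ : HalfRingˣ) : HalfRing) *
          transOp (-lam) (pathOp b (zPar vUnit) (List.ofFn fun j => (β j, d j))
            (ket HalfRing w 0)) (u, mu)) := by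
  classical
  rw [transOp_pathOp_ket_apply, chainSumNeg, map_sum, ← mul_assoc, Finset.mul_sum]
  simp only [zero_add]
  refine Finset.sum_congr (by congr) fun J hJ => ?_
  have hJ' : ChainDesc b β J u w := (Finset.mem_filter.1 hJ).2.1
  have h := hJ'.even b
  rw [List.length_map, Finset.length_sort] at h
  rw [mul_assoc, map_mul, map_chain_term b h, map_pow, map_neg, map_one]
  ring

variable {l : ℕ} (β : Fin l → ι) (d : Fin l → ℤ) (lam : X) (J : Finset (Fin l))

theorem sort_le_map_rev :
    (J.map Fin.revPerm.toEmbedding).sort (· ≤ ·) = (J.sort (· ≥ ·)).map Fin.rev :=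
  (Finset.map_sort (f := Fin.revPerm.toEmbedding) J _ _ fun _ _ _ _ => Fin.rev_le_rev.symm).symm

theorem sort_ge_map_rev :
    (J.map Fin.revPerm.toEmbedding).sort (· ≥ ·) = (J.sort (· ≤ ·)).map Fin.rev :=
  (Finset.map_sort (f := Fin.revPerm.toEmbedding) J (· ≤ ·) (· ≥ ·)
    fun _ _ _ _ => Fin.rev_le_rev.symm).symm

theorem chainDesc_reverse (u w : P.weylGroup) :
    ChainDesc b (fun j => negIdx P (β j.rev)) (J.map Fin.revPerm.toEmbedding) u w ↔
      ChainAsc b β J u w := by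
  rw [ChainDesc, ChainAsc, sort_ge_map_rev, ← bruhatChain_map_negIdx b (L := List.map β _),
    List.map_map, List.map_map]
  simp only [Function.comp_def, Fin.rev_rev]

theorem rHat_reverse (x : X) :
    rHat P (fun j => negIdx P (β j.rev)) (fun j => P.coroot' (β j.rev) lam - d j.rev)
      (J.map Fin.revPerm.toEmbedding) x = rTilde P lam β d J x := by
  rw [rHat, rTilde, sort_le_map_rev, List.foldr_map]
  simp only [Fin.rev_rev, negIdx_negIdx]

theorem nNeg_reverse :
    nNeg b (fun j => negIdx P (β j.rev)) (J.map Fin.revPerm.toEmbedding) + nNeg b β J = J.card := by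
  classical
  rw [nNeg_eq_card, nNeg_eq_card, Finset.filter_map, Finset.card_map]
  simp only [Function.comp_def, isPos_negIdx, not_not, Equiv.coe_toEmbedding, Fin.revPerm_apply,
    Fin.rev_rev]
  exact Finset.card_filter_add_card_filter_not _

/-- The second sum of a chain is the first sum of the chain for `-λ` obtained by going backwards
along the alcove path and translating it by `λ`. -/
theorem chainSumPos_eq_chainSumNeg (w u : P.weylGroup) (mu : X) :
    chainSumPos b lam β d w u mu = chainSumNeg b (-lam) (fun j => negIdx P (β j.rev))
      (fun j => P.coroot' (β j.rev) lam - d j.rev) w u mu := by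
  classical
  rw [chainSumPos, chainSumNeg, Finset.sum_filter, Finset.sum_filter]
  refine Fintype.sum_equiv Fin.revPerm.finsetCongr _ _ fun J => ?_
  rw [Equiv.finsetCongr_apply, Finset.card_map]
  simp only [chainDesc_reverse, rHat_reverse, neg_neg]
  have h := nNeg_reverse b β J
  set m := nNeg b (fun j => negIdx P (β j.rev)) (J.map Fin.revPerm.toEmbedding)
  have e : ((-1) ^ nNeg b β J * (q - 1) ^ J.card : R) = (-1) ^ m * (1 - q) ^ J.card := by
    rw [← neg_sub 1 q, neg_pow (1 - q), ← mul_assoc, ← h, pow_add, mul_left_comm, ← pow_add,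
      ← two_mul, pow_mul]
    simp
  rw [e]

end PathSum

end HeckeChain

end


open HeckeChain in
theorem theorem3p4 {ι X Y : Type*} [Finite ι] [AddCommGroup X] [AddCommGroup Y]
    (P : RootPairing ι ℤ X Y) [P.IsReduced] (b : P.Base)
    (hsc : Submodule.span ℤ (Set.range P.coroot) = ⊤) :
    (∃ B' : Module.Basis (P.weylGroup × X) R (AffineHecke b),
      ∀ (w : P.weylGroup) (lam : X), B' (w, lam) = heckeTinv b w * heckeX b lam) ∧
    ∃ B : Module.Basis (P.weylGroup × X) R (AffineHecke b),
      (∀ (u : P.weylGroup) (mu : X), B (u, mu) = heckeX b mu * heckeTinv b u) ∧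
      ∀ (lam : X) (l : ℕ) (β : Fin l → ι) (d : Fin l → ℤ), IsReducedChain b lam β d →
        ∀ (w u : P.weylGroup) (mu : X),
          B.repr (heckeTinv b w * heckeX b (-lam)) (u, mu) = chainSumNeg b lam β d w u mu ∧
          B.repr (heckeTinv b w * heckeX b lam) (u, mu) = chainSumPos b lam β d w u mu := by
  have := finite_coweight hsc
  refine ⟨⟨basisTX b hsc, basisTX_apply b hsc⟩, basisXT b hsc, basisXT_apply b hsc,
    fun lam l β d h w u mu => ⟨?_, ?_⟩⟩
  -- `HeckeRing b` and `AffineHecke b`, and the elements named in them, agree by definition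
  · apply algebraMap_halfRing_injective
    refine (algebraMap_basisXT_repr b hsc (elTinv b w * elX b (-lam)) (u, mu)).trans ?_
    rw [rep_elTinv_mul_elX_ket b hsc vUnit algebraMap_T h.stepPath, algebraMap_chainSumNeg]
    rfl
  · apply algebraMap_halfRing_injective
    refine (algebraMap_basisXT_repr b hsc (elTinv b w * elX b lam) (u, mu)).trans ?_
    rw [rep_elTinv_mul_elX_ket b hsc vUnit algebraMap_T h.stepPath_rev, chainSumPos_eq_chainSumNeg,
      algebraMap_chainSumNeg, neg_neg]
    rfl
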